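/- Let $d\ge 1$ and $M\ge 2$, and let $\mathrm P$ be a probability distribution of a pair $(X,Y)$ with $X\in\mathbb R^d$ and $Y\in\{1,\dots,M\}$, such that $X$ is uniformly distributed on $[0,1]^d$ and $\pi_m:=\mathrm P(Y=m)>0$ for all $m$. Let $\eta_m(x)=\mathrm P(Y=m\mid X=x)$ and $$\eta^w_m(x)=\frac{\eta_m(x)/\pi_m}{\sum_{j=1}^M\eta_j(x)/\pi_j}.$$ Assume that - (smoothness) for some $\alpha\ge 0$ and $c_L>0$, $|\eta_m(x')-\eta_m(x)|\le c_L\|x'-x\|^\alpha$ for all $x,x'\in[0,1]^d$ and all $m$; - (margin) for some $\beta>0$ and $c_\beta>0$, $\mathrm P\bigl(|\eta^w_{(1)}(X)-\eta^w_{(2)}(X)|\le t\bigr)\le c_\beta t^\beta$ for all $t>0$, where $\eta^w_{(1)}(x)\ge\eta^w_{(2)}(x)$ are the two largest entries (with multiplicity) of $(\eta^w_m(x))_{m=1}^M$. For measurable $f:\mathbb R^d\to\{1,\dots,M\}$ let $r_{\mathrm{AM}}(f)=\frac1M\sum_{m=1}^M\mathrm P(f(X)=m\mid Y=m)$, and let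 the AM-regret be $\mathfrak R_{\mathrm{AM}}(f)=\sup_g r_{\mathrm{AM}}(g)-r_{\mathrm{AM}}(f)$, the supremum being over all measurable $g$. Given i.i.d. data $D_n=\{(X_i,Y_i)\}_{i=1}^n\sim\mathrm P^n$, let $n_{(m)}$ be the number of data points of class $m$ and $\rho=M\min_m n_{(m)}/n$. The under-bagging 1-NN classifier $\widehat f^{B,u}$ with parameters $s$ and $B$ is built as follows. In each of $B$ rounds, which are independent given $D_n$, every data point $(X_i,Y_i)$ is accepted independently with probability $s/(Mn_{(Y_i)})$. In round $b$ let $\widehat\eta^{b,u}_m(x)$ be $1$ if the accepted point nearest to $x$ in Euclidean distance has label $m$ and $0$ otherwise (it is $0$ for all $m$ if no point is accepted). Then $\widehat f^{B,u}(x)\in\arg\max_m\frac1B\sum_{b=1}^B\widehat\eta^{b,u}_m(x)$, with ties for the maximum broken in any measurable way. Then there are $N\in\mathbb N$ and $c>0$, not depending on $n$, such that for all $n\ge N$ the following hold, where the real value given for $B$ is rounded up or down to an integer. (i) If $d>2\alpha$, $s=(\rho n)^{\frac{d}{2\alpha+d}}(\log(\rho n))^{\frac{2\alpha-d}{2\alpha+d}}$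 and $B=(\rho n)^{\frac{2\alpha}{2\alpha+d}}(\log(\rho n))^{\frac{d-2\alpha}{2\alpha+d}}$, then, with probability at least $1-5/n^2$ over the data and the acceptance variables, $$\mathfrak R_{\mathrm{AM}}(\widehat f^{B,u})\le c\,\Bigl(\frac{\log^2 n}{n}\Bigr)^{\alpha(\beta+1)/(2\alpha+d)}.$$ (ii) If $d\le 2\alpha$, $s=(\rho n\log(\rho n))^{1/2}$ and $B=(\rho n/\log(\rho n))^{1/2}$, then, with probability at least $1-5/n^2$ over the data and the acceptance variables, $$\mathfrak R_{\mathrm{AM}}(\widehat f^{B,u})\le c\,\max\Bigl\{\Bigl(\frac{\log n}{n}\Bigr)^{\alpha/(2d)},\Bigl(\frac{\log^3 n}{n}\Bigr)^{1/4}\Bigr\}^{\beta+1}.$$ -/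

import Mathlib

open MeasureTheory ProbabilityTheory
open scoped ENNReal

noncomputable section

/-- The feature space `ℝ^d` with its Euclidean norm. -/
abbrev Feature (d : ℕ) : Type := EuclideanSpace ℝ (Fin d)

/-- The cube `[0,1]^d`. -/
def unitCube (d : ℕ) : Set (Feature d) := {x | ∀ i, x i ∈ Set.Icc (0 : ℝ) 1}

/-- A data set `D_n` of `n` labelled points. The `M` classes are the elements of `Fin M`. -/
abbrev DataSet (n d M : ℕ) : Type := Fin n → Feature d × Fin M

section Population

variable {d M : ℕ} (P : Measure (Feature d × Fin M))

/-- The class proportion `π_m = P(Y = m)`. -/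
def classProb (m : Fin M) : ℝ := P.real {p | p.2 = m}

/-- The posterior probability `η_m(x) = P(Y = m | X = x)`, read off from a version `κ` of the
conditional distribution of the label given the feature. -/
def posterior (κ : Kernel (Feature d) (Fin M)) (x : Feature d) (m : Fin M) : ℝ := (κ x).real {m}

/-- The weighted posterior probability `η^w_m(x)`. -/
def weightedPosterior (κ : Kernel (Feature d) (Fin M)) (x : Feature d) (m : Fin M) : ℝ :=
  (posterior κ x m / classProb P m) / ∑ j, posterior κ x j / classProb P j

/-- The entries of `v` in decreasing order: `kthLargest v 0` is the largest entry,
`kthLargest v 1` the second largest one (counted with multiplicity), and so on. -/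
def kthLargest (v : Fin M → ℝ) (j : Fin M) : ℝ := v (Tuple.sort v j.rev)

/-- Every `η_m` is `α`-Hölder continuous on the cube, with constant `cL`. -/
def HolderPosterior (κ : Kernel (Feature d) (Fin M)) (α cL : ℝ) : Prop :=
  ∀ x ∈ unitCube d, ∀ x' ∈ unitCube d, ∀ m,
    |posterior κ x' m - posterior κ x m| ≤ cL * ‖x' - x‖ ^ α

/-- The margin condition on `η^w` with exponent `β` and constant `cβ`. -/
def MarginCondition (κ : Kernel (Feature d) (Fin M)) (hM : 2 ≤ M) (β cβ : ℝ) : Prop :=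
  ∀ t : ℝ, 0 < t →
    P.real {p | |kthLargest (weightedPosterior P κ p.1) ⟨0, by omega⟩
      - kthLargest (weightedPosterior P κ p.1) ⟨1, by omega⟩| ≤ t} ≤ cβ * t ^ β

/-- The recall `r_m(f) = P(f(x) = m | y = m)`. -/
def classRecall (f : Feature d → Fin M) (m : Fin M) : ℝ :=
  (cond P {p | p.2 = m}).real {p | f p.1 = m}

/-- The arithmetic mean `r_AM(f)` of the recalls. -/
def amRecall (f : Feature d → Fin M) : ℝ := (1 / (M : ℝ)) * ∑ m, classRecall P f m

/-- The AM-regret `r_AM^* - r_AM(f)`. -/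
def amRegret (f : Feature d → Fin M) : ℝ :=
  sSup (amRecall P '' {g | Measurable g}) - amRecall P f

end Population

section Algorithm

variable {n d M : ℕ}

/-- The number `n_(m)` of data points of class `m`. -/
def classCount (D : DataSet n d M) (m : Fin M) : ℕ := (Finset.univ.filter fun i => (D i).2 = m).card

/-- The size of the minority class. -/
def minorityCount (D : DataSet n d M) : ℕ := ⨅ m, classCount D m

/-- The imbalance ratio `ρ`. -/
def imbalanceRatio (D : DataSet n d M) : ℝ := M * minorityCount D / n

/-- The acceptance probability `a(x, y)`, a function of the label `y` only. -/
def acceptProb (D : DataSet n d M) (s : ℝ) (y : Fin M) : ℝ := s / (M * classCount D y)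

/-- The law of the acceptance indicators of one round given the data: independent Bernoulli
variables with parameters `a(X_i, Y_i)`. (The projection onto `[0,1]` changes nothing when
`0 ≤ s ≤ M n_(1)`.) -/
def roundLaw (D : DataSet n d M) (s : ℝ) : Measure (Fin n → Bool) :=
  Measure.pi fun i =>
    bernoulliMeasure true false (Set.projIcc (0 : ℝ) 1 zero_le_one (acceptProb D s (D i).2))

/-- The law of the acceptance indicators of `B` independent rounds given the data. -/
def baggingLaw (D : DataSet n d M) (s : ℝ) (B : ℕ) : Measure (Fin B → Fin n → Bool) :=
  Measure.pi fun _ => roundLaw D s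

/-- The data point `j` comes before the data point `i` when the data are ordered by the distance
to `x` (equal distances are ordered by index). -/
def Precedes (D : DataSet n d M) (x : Feature d) (j i : Fin n) : Prop :=
  dist (D j).1 x < dist (D i).1 x ∨ (dist (D j).1 x = dist (D i).1 x ∧ j < i)

open Classical in
/-- The number of accepted data points that are nearer to `x` than the data point `i`. An accepted
`i` is one of the `k` nearest neighbours of `x` in the subsample if this number is below `k`. -/
def nnRank (D : DataSet n d M) (z : Fin n → Bool) (x : Feature d) (i : Fin n) : ℕ :=
  (Finset.univ.filter fun j => z j = true ∧ Precedes D x j i).card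

/-- The `k`-NN posterior estimate on the subsample of the points accepted by `z`. -/
def roundPosterior (k : ℕ) (D : DataSet n d M) (z : Fin n → Bool) (x : Feature d) (m : Fin M) : ℝ :=
  (1 / (k : ℝ)) *
    (Finset.univ.filter fun i => z i = true ∧ nnRank D z x i < k ∧ (D i).2 = m).card

/-- The average of the `k`-NN posterior estimates over the `B` rounds. -/
def baggedPosterior (k : ℕ) (D : DataSet n d M) {B : ℕ} (Z : Fin B → Fin n → Bool)
    (x : Feature d) (m : Fin M) : ℝ :=
  (1 / (B : ℝ)) * ∑ b, roundPosterior k D (Z b) x m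

/-- `f` is an under-bagging `k`-NN classifier: a measurable choice of a maximiser over the classes
of the bagged posterior estimate. -/
def IsUnderBaggingClassifier (k : ℕ) (D : DataSet n d M) {B : ℕ} (Z : Fin B → Fin n → Bool)
    (f : Feature d → Fin M) : Prop :=
  Measurable f ∧ ∀ x m, baggedPosterior k D Z x m ≤ baggedPosterior k D Z x (f x)

/-- The probability, over the data `D ∼ P^n` and, given `D`, the acceptance indicators of `B D`
rounds with expected subsample size `s D`, that the AM-regret of the under-bagging `k`-NN
classifier is at most `r`, however ties for the maximum are broken. -/
def regretBoundProb (P : Measure (Feature d × Fin M)) (n k : ℕ) (s : DataSet n d M → ℝ)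
    (B : DataSet n d M → ℕ) (r : ℝ) : ℝ≥0∞ :=
  ∫⁻ D, baggingLaw D (s D) (B D) {Z | ∀ f, IsUnderBaggingClassifier k D Z f → amRegret P f ≤ r}
    ∂(Measure.pi fun _ : Fin n => P)

/-- `B` is the real number `b D` rounded to an integer, up or down, for every data set `D`. -/
def IsRounding (B : DataSet n d M → ℕ) (b : DataSet n d M → ℝ) : Prop :=
  ∀ D, |(B D : ℝ) - b D| < 1

end Algorithm

end

noncomputable section

/-! ### Product measures: Hoeffding bounds, sections, conditional independence of labels -/

section ProductMeasures

variable {Ω Ξ : Type*} [MeasurableSpace Ω] [MeasurableSpace Ξ]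

/-! At a fixed point `x`, the averaged vote differs from `η^w(x)` by four errors, with `a` the
acceptance probabilities and `φ` the target rate.

(1) The average of `B` rounds differs from its expectation given the data by order `√(log n / B)`,
by Hoeffding (`baggingLaw_deviation_le`). (2) That expectation is the sum over points of label `m`
of the weights `w_i = a(Y_i) ∏ (1 - a(Y_j))`, with `j` running over the points nearer to `x`. The
weights depend on the labels, so the indicator of label `m` is centred at the reweighted posterior
`q = aη / ∑ aη`. Given the features, ordered by distance to `x`, the centred sum is a martingale
whose increments are discounted by factors `1 - a`. It is sub-Gaussian with variance proxy of order
`s / n`, hence of size `√(s log n / n)` (`sum_exp_discounted_le`, `measure_centeredPart_ge_le`). (3)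
What remains is a weighted average of `q` over the data. Some point within distance of order `(log n
/ s)^(1/d)` is very likely accepted, so by smoothness the bias is of order `(log n / s)^(α/d)`
(`abs_expectedPosterior_sub_le`, `measure_prod_ite_ge_le`). (4) `q` differs from `η^w` only by class
frequencies in place of class proportions, an error of order `√(log n / n)`
(`abs_reweightedPosterior_sub_weightedPosterior_le`).

Two devices turn this into a regret bound. The acceptance probabilities depend on the data through
the class counts, which would destroy the martingale; so the counts are frozen at each possible
vector, and a union bound over `(n + 1)^M` vectors costs only a power of `n`. No uniformity in `x`
is needed: by Tonelli and Markov (`measure_section_gt_le`), pointwise bounds show that with high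
probability the bad `x` have mass below `φ^(β+1)`. They cost the regret `O(φ^(β+1))`. At a good `x`
the classifier is `O(φ)`-optimal and loses something only if the two largest entries of `η^w` are
`O(φ)`-close, which has probability `O(φ^β)` by the margin condition (`amRegret_le`).

`exists_regret_bound` combines these for any `s`, `B` that keep the errors of order `φ`;
`rate_of_two_mul_lt` and `rate_of_le_two_mul` verify this for the two prescribed choices. -/

lemma hoeffding_pi_upper (ν : Measure Ω) [IsProbabilityMeasure ν] {f : Ω → ℝ} (hf : Measurable f)
    (h01 : ∀ ω, f ω ∈ Set.Icc (0 : ℝ) 1) (n : ℕ) {t : ℝ} (ht : 0 ≤ t) :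
    (Measure.pi fun _ : Fin n => ν).real {ω | n * t ≤ ∑ i, f (ω i) - n * ∫ z, f z ∂ν}
      ≤ Real.exp (-2 * n * t ^ 2) := by
  have hsub := hasSubgaussianMGF_of_mem_Icc (μ := ν) (X := f) hf.aemeasurable
    (a := 0) (b := 1) (Filter.Eventually.of_forall h01)
  have hind : iIndepFun (fun (i : Fin n) (ω : Fin n → Ω) => f (ω i) - ∫ z, f z ∂ν)
      (Measure.pi fun _ : Fin n => ν) :=
    iIndepFun_pi (X := fun _ z => f z - ∫ z, f z ∂ν)
      (fun _ => (hf.sub_const _).aemeasurable)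
  have hs : ∀ i ∈ (Finset.univ : Finset (Fin n)),
      HasSubgaussianMGF (fun ω : Fin n → Ω => f (ω i) - ∫ z, f z ∂ν)
        ((‖(1 : ℝ) - 0‖₊ / 2) ^ 2) (Measure.pi fun _ : Fin n => ν) := by
    intro i _
    refine HasSubgaussianMGF.of_map (Y := fun ω : Fin n → Ω => ω i)
      (X := fun z => f z - ∫ z, f z ∂ν) (measurable_pi_apply i).aemeasurable ?_
    rw [(measurePreserving_eval (fun _ : Fin n => ν) i).map_eq]
    exact hsub
  have h := HasSubgaussianMGF.measure_sum_ge_le_of_iIndepFun hind hs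
    (ε := n * t) (by positivity)
  refine le_trans (le_of_eq ?_) (h.trans (le_of_eq ?_))
  · congr 1
    ext ω
    simp [Finset.sum_sub_distrib]
  · congr 1
    simp only [sub_zero, nnnorm_one, Finset.sum_const, Finset.card_univ, Fintype.card_fin]
    rcases Nat.eq_zero_or_pos n with rfl | hn
    · simp
    · have : (n : ℝ) ≠ 0 := by positivity
      push_cast
      simp only [nsmul_eq_mul]
      field_simp

lemma hoeffding_pi (ν : Measure Ω) [IsProbabilityMeasure ν] {f : Ω → ℝ} (hf : Measurable f)
    (h01 : ∀ ω, f ω ∈ Set.Icc (0 : ℝ) 1) (n : ℕ) {t : ℝ} (ht : 0 ≤ t) :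
    (Measure.pi fun _ : Fin n => ν) {ω | n * t ≤ |∑ i, f (ω i) - n * ∫ z, f z ∂ν|}
      ≤ ENNReal.ofReal (2 * Real.exp (-2 * n * t ^ 2)) := by
  have h1 := hoeffding_pi_upper ν hf h01 n ht
  -- The lower tail of `f` is the upper tail of `1 - f`.
  have h2 := hoeffding_pi_upper ν (f := fun z => 1 - f z) (measurable_const.sub hf)
    (fun ω => ⟨by linarith [(h01 ω).2], by linarith [(h01 ω).1]⟩) n ht
  have hint : Integrable f ν := Integrable.of_bound hf.aestronglyMeasurable 1
    (Filter.Eventually.of_forall fun ω => by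
      rw [Real.norm_eq_abs, abs_of_nonneg (h01 ω).1]; exact (h01 ω).2)
  rw [integral_sub (integrable_const _) hint] at h2
  simp only [integral_const, probReal_univ, smul_eq_mul, mul_one, Finset.sum_sub_distrib,
    Finset.sum_const, Finset.card_univ, Fintype.card_fin, nsmul_eq_mul] at h2
  rw [← ofReal_measureReal]
  apply ENNReal.ofReal_le_ofReal
  refine (measureReal_mono (s₂ := {ω : Fin n → Ω | n * t ≤ ∑ i, f (ω i) - n * ∫ z, f z ∂ν} ∪
    {ω | n * t ≤ n - ∑ i, f (ω i) - n * (1 - ∫ z, f z ∂ν)}) ?_).trans ?_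
  · intro ω hω
    simp only [Set.mem_ofPred_eq, Set.mem_union] at hω ⊢
    rcases le_abs.1 hω with h | h
    · exact Or.inl h
    · right; linarith
  · refine (measureReal_union_le _ _).trans ?_
    linarith

/-- Markov's inequality for the measure of the sections of a set in a product space. -/
lemma measure_section_gt_le (ν : Measure Ω) [SFinite ν] (μ : Measure Ξ) [IsProbabilityMeasure μ]
    {A : Set (Ω × Ξ)} (hA : MeasurableSet A) {δ τ : ℝ} (hτ : 0 < τ)
    (h : ∀ᵐ x ∂μ, ν {ω | (ω, x) ∈ A} ≤ ENNReal.ofReal δ) :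
    ν {ω | ENNReal.ofReal τ ≤ μ {x | (ω, x) ∈ A}} ≤ ENNReal.ofReal (δ / τ) := by
  have hm : Measurable fun ω => μ {x | (ω, x) ∈ A} := measurable_measure_prodMk_left hA
  have h1 := mul_meas_ge_le_lintegral (μ := ν) hm (ENNReal.ofReal τ)
  have h2 : ∫⁻ ω, μ {x | (ω, x) ∈ A} ∂ν = ∫⁻ x, ν {ω | (ω, x) ∈ A} ∂μ := by
    have e1 := Measure.prod_apply (μ := ν) (ν := μ) hA
    have e2 := Measure.prod_apply_symm (μ := ν) (ν := μ) hA
    exact e1.symm.trans e2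
  have h3 : ∫⁻ x, ν {ω | (ω, x) ∈ A} ∂μ ≤ ENNReal.ofReal δ := by
    refine (lintegral_mono_ae h).trans ?_
    simp
  rw [ENNReal.ofReal_div_of_pos hτ, ENNReal.le_div_iff_mul_le (by simp [hτ]) (by simp), mul_comm]
  exact h1.trans (h2 ▸ h3)

lemma lintegral_pi_prod {n : ℕ} (ν : Measure Ω) [IsProbabilityMeasure ν] {f : Fin n → Ω → ℝ≥0∞}
    (hf : ∀ i, Measurable (f i)) :
    ∫⁻ ω, ∏ i, f i (ω i) ∂(Measure.pi fun _ : Fin n => ν) = ∏ i, ∫⁻ z, f i z ∂ν := by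
  have hind : iIndepFun (fun (i : Fin n) (ω : Fin n → Ω) => f i (ω i))
      (Measure.pi fun _ : Fin n => ν) := iIndepFun_pi (X := f) (fun i => (hf i).aemeasurable)
  have h := lintegral_prod_eq_prod_lintegral_of_indepFun Finset.univ _ hind
    (fun i => (hf i).comp (measurable_pi_apply i))
  rw [h]
  refine Finset.prod_congr rfl fun i _ => ?_
  exact (measurePreserving_eval (fun _ : Fin n => ν) i).lintegral_comp (hf i)

/-- The joint law of an i.i.d. sample of features and finitely valued labels, disintegrated: the
labels are conditionally independent given the features. -/
lemma pi_eq_sum_withDensity {M n : ℕ} (P : Measure (Ω × Fin M)) [IsProbabilityMeasure P]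
    (κ : Kernel Ω (Fin M)) [IsMarkovKernel κ] [P.IsCondKernel κ] :
    Measure.pi (fun _ : Fin n => P) = ∑ y : Fin n → Fin M,
      ((Measure.pi fun _ : Fin n => P.fst).withDensity fun X => ∏ i, κ (X i) {y i}).map
        (fun X i => (X i, y i)) := by
  classical
  apply Measure.pi_eq
  intro s hs
  have hmeas : ∀ y : Fin n → Fin M, Measurable fun (X : Fin n → Ω) i => (X i, y i) := by
    intro y; fun_prop
  have hP : ∀ i, P (s i) = ∑ l, ∫⁻ x, ({x | (x, l) ∈ s i}.indicator (fun x => κ x {l}) x) ∂P.fst := by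
    intro i
    conv_lhs => rw [← P.disintegrate κ]
    rw [Measure.compProd_apply (hs i), ← lintegral_finsetSum]
    · refine lintegral_congr fun x => ?_
      rw [← Measure.tsum_indicator_apply_singleton _ _
        (measurable_prodMk_left (hs i)), tsum_fintype]
      simp only [Set.indicator_apply, Set.mem_preimage, Set.mem_ofPred_eq]
    · intro l _
      exact (κ.measurable_coe (measurableSet_singleton l)).indicator
        ((measurable_id.prodMk measurable_const) (hs i))
  simp_rw [hP]
  -- Expanding a product of sums over labels yields the sum over label vectors.
  rw [Finset.prod_univ_sum, Fintype.piFinset_univ, Measure.finsetSum_apply]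
  refine Finset.sum_congr rfl fun y _ => ?_
  rw [Measure.map_apply (hmeas y) (MeasurableSet.univ_pi hs), withDensity_apply _
    ((hmeas y) (MeasurableSet.univ_pi hs)), ← lintegral_pi_prod]
  · rw [← lintegral_indicator ((hmeas y) (MeasurableSet.univ_pi hs))]
    refine lintegral_congr fun X => ?_
    simp only [Set.indicator_apply, Set.mem_preimage, Set.mem_ofPred_eq, Set.mem_univ_pi]
    by_cases h : ∀ i, (X i, y i) ∈ s i
    · simp [h]
    · obtain ⟨i, hi⟩ := not_forall.1 h
      rw [if_neg h, eq_comm, Finset.prod_eq_zero (Finset.mem_univ i)]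
      simp [hi]
  · intro i
    exact (κ.measurable_coe (measurableSet_singleton (y i))).indicator
        ((measurable_id.prodMk measurable_const) (hs i))

end ProductMeasures

/-! ### Discounted martingales, discounted averages and normalisation -/

section FiniteSums

/-- Hoeffding's lemma for a finitely supported law: on `[-c, c]` convexity puts the exponential
below its chord, the linear part of the chord vanishes by centring, and `cosh x ≤ exp (x ^ 2 / 2)`.
-/
lemma sum_mul_exp_le_of_mean_zero {ι : Type*} [Fintype ι] {p v : ι → ℝ} {c : ℝ}
    (hp : ∀ l, 0 ≤ p l) (hp1 : ∑ l, p l = 1) (hv : ∑ l, p l * v l = 0) (hc : ∀ l, |v l| ≤ c)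
    (g : ℝ) : ∑ l, p l * Real.exp (g * v l) ≤ Real.exp (g ^ 2 * c ^ 2 / 2) := by
  obtain ⟨l₀⟩ : Nonempty ι := by
    by_contra h
    rw [not_nonempty_iff] at h
    simp at hp1
  have hc0 : 0 ≤ c := (abs_nonneg _).trans (hc l₀)
  rcases hc0.eq_or_lt with rfl | hc0
  · have : ∀ l, v l = 0 := fun l => abs_nonpos_iff.1 (hc l)
    simp [this, hp1]
  · have h1 : ∀ l, p l * Real.exp (g * v l) ≤
        p l * Real.cosh (g * c) + p l * v l * (Real.sinh (g * c) / c) := by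
      intro l
      have ht : |v l / c| ≤ 1 := by
        rw [abs_div, abs_of_pos hc0]
        exact (div_le_one hc0).2 (hc l)
      have h := Real.exp_mul_le_cosh_add_mul_sinh ht (g * c)
      have e : v l / c * (g * c) = g * v l := by field_simp
      rw [e] at h
      calc p l * Real.exp (g * v l) ≤ p l * _ := mul_le_mul_of_nonneg_left h (hp l)
        _ = _ := by ring
    calc ∑ l, p l * Real.exp (g * v l)
        ≤ ∑ l, (p l * Real.cosh (g * c) + p l * v l * (Real.sinh (g * c) / c)) :=
          Finset.sum_le_sum fun l _ => h1 l
      _ = Real.cosh (g * c) := by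
          rw [Finset.sum_add_distrib, ← Finset.sum_mul, ← Finset.sum_mul, hp1, hv]; ring
      _ ≤ Real.exp ((g * c) ^ 2 / 2) := Real.cosh_le_exp_half_sq _
      _ = _ := by rw [mul_pow]

/-- The exponential moments of a martingale whose increments are discounted at each step. -/
lemma sum_exp_discounted_le {M : ℕ} {θ : Fin M → ℝ} {r c V : ℝ} (hθ : ∀ l, |θ l| ≤ r)
    (hV0 : 0 ≤ V) (hV : c ^ 2 + r ^ 2 * V ≤ V) :
    ∀ (n : ℕ) (p v : Fin n → Fin M → ℝ), (∀ i l, 0 ≤ p i l) → (∀ i, ∑ l, p i l = 1) →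
      (∀ i, ∑ l, p i l * v i l = 0) → (∀ i l, |v i l| ≤ c) → ∀ g : ℝ,
      ∑ y : Fin n → Fin M, (∏ i, p i (y i)) *
        Real.exp (g * ∑ i, (∏ j, if j < i then θ (y j) else 1) * v i (y i))
        ≤ Real.exp (g ^ 2 * V / 2) := by
  intro n
  induction n with
  | zero =>
    intro p v _ _ _ _ g
    simp only [Finset.univ_unique, Finset.univ_eq_empty, Finset.prod_empty, Finset.sum_empty,
      mul_zero, Real.exp_zero, mul_one, Finset.sum_const, Finset.card_singleton, one_smul]
    exact Real.one_le_exp (by positivity)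
  | succ n ih =>
    intro p v hp hp1 hv hc g
    -- All later terms share the discount `θ l` of the first point, so the sum is `v 0 l` plus `θ l`
    -- times a sum of the same kind.
    have key : ∀ (l : Fin M) (y : Fin n → Fin M),
        g * ∑ i : Fin (n + 1), (∏ j, if j < i then θ (Fin.cons (α := fun _ => Fin M) l y j) else 1)
          * v i (Fin.cons (α := fun _ => Fin M) l y i)
        = g * v 0 l + (g * θ l) * ∑ i : Fin n, (∏ j, if j < i then θ (y j) else 1)
          * v i.succ (y i) := by
      intro l y
      rw [Fin.sum_univ_succ]
      simp only [Fin.prod_univ_succ, Fin.cons_zero, Fin.cons_succ, Fin.succ_lt_succ_iff,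
        Fin.succ_pos, if_true, Fin.not_lt_zero, if_false, Finset.prod_const_one, one_mul]
      simp only [mul_add, mul_assoc, Finset.mul_sum]
    rw [← (Fin.consEquiv fun _ => Fin M).sum_comp, Fintype.sum_prod_type]
    calc _ = ∑ l : Fin M, p 0 l * Real.exp (g * v 0 l) * ∑ y : Fin n → Fin M,
          (∏ i, p i.succ (y i)) * Real.exp ((g * θ l) *
            ∑ i, (∏ j, if j < i then θ (y j) else 1) * v i.succ (y i)) := by
          refine Finset.sum_congr rfl fun l _ => ?_
          rw [Finset.mul_sum]
          refine Finset.sum_congr rfl fun y _ => ?_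
          have := key l y
          simp only [Fin.consEquiv, Equiv.coe_fn_mk] at this ⊢
          rw [this, Real.exp_add, Fin.prod_univ_succ]
          simp only [Fin.cons_zero, Fin.cons_succ]
          ring
      _ ≤ ∑ l : Fin M, p 0 l * Real.exp (g * v 0 l) * Real.exp (g ^ 2 * (r ^ 2 * V) / 2) := by
          refine Finset.sum_le_sum fun l _ => ?_
          refine mul_le_mul_of_nonneg_left ?_ (mul_nonneg (hp 0 l) (Real.exp_pos _).le)
          -- The shared discount is absorbed into the exponential parameter, which is why the
          -- induction is for all `g`.
          refine (ih (fun i => p i.succ) (fun i => v i.succ) (fun i => hp _) (fun i => hp1 _)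
            (fun i => hv _) (fun i => hc _) (g * θ l)).trans ?_
          have h2 : θ l ^ 2 ≤ r ^ 2 := sq_le_sq' (by linarith [(abs_le.1 (hθ l)).1])
            (abs_le.1 (hθ l)).2
          apply Real.exp_le_exp.2
          rw [mul_pow]
          have : g ^ 2 * (θ l ^ 2 * V) ≤ g ^ 2 * (r ^ 2 * V) := by gcongr
          linarith
      _ ≤ Real.exp (g ^ 2 * c ^ 2 / 2) * Real.exp (g ^ 2 * (r ^ 2 * V) / 2) := by
          rw [← Finset.sum_mul]
          exact mul_le_mul_of_nonneg_right
            (sum_mul_exp_le_of_mean_zero (hp 0) (hp1 0) (hv 0) (hc 0) g) (Real.exp_pos _).le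
      -- One step turns the variance proxy `V` into `c ^ 2 + r ^ 2 * V`; the hypothesis on `V` makes
      -- the bound independent of `n`.
      _ ≤ Real.exp (g ^ 2 * V / 2) := by
          rw [← Real.exp_add]
          apply Real.exp_le_exp.2
          nlinarith [sq_nonneg g, mul_le_mul_of_nonneg_left hV (sq_nonneg g)]

/-- Chernoff's bound for both signs, at the parameter `t / V` that minimises `-g * t + g ^ 2 * V /
2`. -/
lemma sum_ite_discounted_le {M n : ℕ} {θ : Fin M → ℝ} {r c V t : ℝ} (ht : 0 ≤ t) (hθ : ∀ l, |θ l| ≤ r)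
    (hV0 : 0 < V) (hV : c ^ 2 + r ^ 2 * V ≤ V)
    {p v : Fin n → Fin M → ℝ} (hp : ∀ i l, 0 ≤ p i l) (hp1 : ∀ i, ∑ l, p i l = 1)
    (hv : ∀ i, ∑ l, p i l * v i l = 0) (hc : ∀ i l, |v i l| ≤ c) :
    ∑ y : Fin n → Fin M, (∏ i, p i (y i)) *
      (if t ≤ |∑ i, (∏ j, if j < i then θ (y j) else 1) * v i (y i)| then 1 else 0)
      ≤ 2 * Real.exp (-t ^ 2 / (2 * V)) := by
  set S : (Fin n → Fin M) → ℝ := fun y => ∑ i, (∏ j, if j < i then θ (y j) else 1) * v i (y i)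
  have h1 := sum_exp_discounted_le hθ hV0.le hV n p v hp hp1 hv hc (t / V)
  have h2 := sum_exp_discounted_le hθ hV0.le hV n p v hp hp1 hv hc (-(t / V))
  have e : Real.exp (-t ^ 2 / (2 * V)) =
      Real.exp (-(t / V * t)) * Real.exp ((t / V) ^ 2 * V / 2) := by
    rw [← Real.exp_add]; congr 1; field_simp; ring
  calc _ ≤ ∑ y : Fin n → Fin M, (∏ i, p i (y i)) * (Real.exp (-(t / V * t)) *
        (Real.exp (t / V * S y) + Real.exp (-(t / V) * S y))) := by
        refine Finset.sum_le_sum fun y _ => ?_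
        refine mul_le_mul_of_nonneg_left ?_ (Finset.prod_nonneg fun i _ => hp _ _)
        split_ifs with h
        · have htV : 0 ≤ t / V := by positivity
          rw [mul_add, ← Real.exp_add, ← Real.exp_add]
          rcases le_abs.1 h with h | h
          · have : 1 ≤ Real.exp (-(t / V * t) + t / V * S y) :=
              Real.one_le_exp (by nlinarith [mul_le_mul_of_nonneg_left h htV])
            linarith [Real.exp_pos (-(t / V * t) + -(t / V) * S y)]
          · have : 1 ≤ Real.exp (-(t / V * t) + -(t / V) * S y) :=
              Real.one_le_exp (by nlinarith [mul_le_mul_of_nonneg_left h htV])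
            linarith [Real.exp_pos (-(t / V * t) + t / V * S y)]
        · positivity
    _ = Real.exp (-(t / V * t)) * (∑ y : Fin n → Fin M, (∏ i, p i (y i)) * Real.exp (t / V * S y)
        + ∑ y : Fin n → Fin M, (∏ i, p i (y i)) * Real.exp (-(t / V) * S y)) := by
        rw [← Finset.sum_add_distrib, Finset.mul_sum]
        exact Finset.sum_congr rfl fun y _ => by ring
    _ ≤ Real.exp (-(t / V * t)) * (Real.exp ((t / V) ^ 2 * V / 2)
        + Real.exp ((t / V) ^ 2 * V / 2)) := by
        rw [neg_sq] at h2
        gcongr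
    _ = _ := by rw [e]; ring

/-- The sum telescopes: it is the probability that some index of `T` is accepted, split according to
the first one. Since `T` is an initial segment, the discounts of its members involve only `T`. -/
lemma sum_mul_prod_one_sub_of_isLowerSet {n : ℕ} (g : Fin n → ℝ) {T : Finset (Fin n)}
    (hT : ∀ i ∈ T, ∀ j, j < i → j ∈ T) :
    ∑ i ∈ T, g i * ∏ j, (if j < i then 1 - g j else 1) = 1 - ∏ i ∈ T, (1 - g i) := by
  rw [Finset.prod_one_sub_ordered, sub_sub_cancel]
  refine Finset.sum_congr rfl fun i hi => ?_
  rw [Finset.prod_filter, ← Finset.prod_subset (Finset.subset_univ T)]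
  intro j _ hj
  rw [if_neg]
  exact fun h => hj (hT i hi j h)

/-- A weighted average with the weights `g i * ∏_{j < i} (1 - g j)` is close to `q₀` if its first
entries are. -/
lemma abs_sum_discounted_sub_le {n : ℕ} {g q : Fin n → ℝ} {q₀ e : ℝ}
    (hg : ∀ i, g i ∈ Set.Icc (0 : ℝ) 1) (hq : ∀ i, q i ∈ Set.Icc (0 : ℝ) 1)
    (hq₀ : q₀ ∈ Set.Icc (0 : ℝ) 1) (he : 0 ≤ e) {T : Finset (Fin n)}
    (hT : ∀ i ∈ T, ∀ j, j < i → j ∈ T) (hqT : ∀ i ∈ T, |q i - q₀| ≤ e) :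
    |∑ i, (g i * ∏ j, (if j < i then 1 - g j else 1)) * q i - q₀| ≤ e + ∏ i ∈ T, (1 - g i) := by
  set w : Fin n → ℝ := fun i => g i * ∏ j, (if j < i then 1 - g j else 1)
  have hw : ∀ i, 0 ≤ w i := fun i => mul_nonneg (hg i).1 <| Finset.prod_nonneg fun j _ => by
    split_ifs
    · linarith [(hg j).2]
    · norm_num
  have hwT : ∑ i ∈ T, w i = 1 - ∏ i ∈ T, (1 - g i) := sum_mul_prod_one_sub_of_isLowerSet g hT
  have hw1 : ∑ i, w i = 1 - ∏ i, (1 - g i) :=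
    sum_mul_prod_one_sub_of_isLowerSet g (by simp)
  have hsplit := Finset.sum_add_sum_compl T w
  have hprod : 0 ≤ ∏ i, (1 - g i) := Finset.prod_nonneg fun j _ => by linarith [(hg j).2]
  have hprodT : 0 ≤ ∏ i ∈ T, (1 - g i) := Finset.prod_nonneg fun j _ => by linarith [(hg j).2]
  -- Three parts: the near indices, the far ones, and the mass missing from the weights. The last
  -- two have total mass `∏ i ∈ T, (1 - g i)`.
  have e1 : ∑ i, w i * q i - q₀ = ∑ i ∈ T, w i * (q i - q₀) + ∑ i ∈ Tᶜ, w i * (q i - q₀)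
      - q₀ * ∏ i, (1 - g i) := by
    rw [Finset.sum_add_sum_compl]
    simp only [mul_sub, Finset.sum_sub_distrib, ← Finset.sum_mul, hw1]
    ring
  have b1 : |∑ i ∈ T, w i * (q i - q₀)| ≤ (∑ i ∈ T, w i) * e := by
    rw [Finset.sum_mul]
    refine (Finset.abs_sum_le_sum_abs _ _).trans (Finset.sum_le_sum fun i hi => ?_)
    rw [abs_mul, abs_of_nonneg (hw i)]
    exact mul_le_mul_of_nonneg_left (hqT i hi) (hw i)
  have b2 : |∑ i ∈ Tᶜ, w i * (q i - q₀)| ≤ ∑ i ∈ Tᶜ, w i := by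
    refine (Finset.abs_sum_le_sum_abs _ _).trans (Finset.sum_le_sum fun i hi => ?_)
    rw [abs_mul, abs_of_nonneg (hw i)]
    refine mul_le_of_le_one_right (hw i) (abs_le.2 ⟨?_, ?_⟩)
    · linarith [(hq i).1, hq₀.2]
    · linarith [(hq i).2, hq₀.1]
  have b3 : |q₀ * ∏ i, (1 - g i)| ≤ ∏ i, (1 - g i) := by
    rw [abs_mul, abs_of_nonneg hprod, abs_of_nonneg hq₀.1]
    exact mul_le_of_le_one_left hprod hq₀.2
  rw [e1]
  have := abs_sub (∑ i ∈ T, w i * (q i - q₀) + ∑ i ∈ Tᶜ, w i * (q i - q₀)) (q₀ * ∏ i, (1 - g i))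
  have := abs_add_le (∑ i ∈ T, w i * (q i - q₀)) (∑ i ∈ Tᶜ, w i * (q i - q₀))
  have b4 : (∑ i ∈ T, w i) * e ≤ e := by
    rw [hwT]
    exact mul_le_of_le_one_left he (by linarith)
  linarith

/-- Normalising nonnegative vectors is Lipschitz. -/
lemma abs_div_sum_sub_div_sum_le {M : ℕ} {u v : Fin M → ℝ} {Δ v₀ : ℝ} (hu : ∀ m, 0 ≤ u m)
    (hU : 0 < ∑ j, u j) (hv₀ : 0 < v₀) (hV : v₀ ≤ ∑ j, v j)
    (h : ∀ m, |u m - v m| ≤ Δ) (m : Fin M) :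
    |u m / ∑ j, u j - v m / ∑ j, v j| ≤ (M + 1) * Δ / v₀ := by
  set U := ∑ j, u j
  set V := ∑ j, v j
  have hVpos : 0 < V := hv₀.trans_le hV
  have hΔ : 0 ≤ Δ := (abs_nonneg _).trans (h m)
  -- In this form only `V` must be bounded away from zero; `U` enters through `u m / U ≤ 1`.
  have e : u m / U - v m / V = ((u m - v m) + (u m / U) * (V - U)) / V := by
    field_simp; ring
  have hUV : |V - U| ≤ M * Δ := by
    rw [abs_sub_comm, ← Finset.sum_sub_distrib]
    refine (Finset.abs_sum_le_sum_abs _ _).trans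
      ((Finset.sum_le_sum fun i _ => h i).trans ?_)
    simp
  have hq : u m / U ≤ 1 :=
    (div_le_one hU).2 (Finset.single_le_sum (fun i _ => hu i) (Finset.mem_univ m))
  have hq0 : 0 ≤ u m / U := div_nonneg (hu m) hU.le
  rw [e, abs_div, abs_of_pos hVpos]
  have : |(u m - v m) + (u m / U) * (V - U)| ≤ (M + 1) * Δ := by
    refine (abs_add_le _ _).trans ?_
    rw [abs_mul, abs_of_nonneg hq0]
    nlinarith [h m, mul_le_mul hq hUV (abs_nonneg _) zero_le_one]
  gcongr

end FiniteSums

/-! ### The expected vote at a point: martingale part, bias and missing mass -/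

section Weights

variable {n d M : ℕ}

open Classical in
/-- The probability that the data point `i` is the accepted point nearest to `x`, when the points
are accepted independently with probabilities `a y` depending on the label. -/
def nnWeight (a : Fin M → ℝ) (D : DataSet n d M) (x : Feature d) (i : Fin n) : ℝ :=
  a (D i).2 * ∏ j, if Precedes D x j i then 1 - a (D j).2 else 1

/-- The expectation of the 1-NN posterior estimate over the acceptance variables. -/
def expectedPosterior (a : Fin M → ℝ) (D : DataSet n d M) (x : Feature d) (m : Fin M) : ℝ :=
  ∑ i, if (D i).2 = m then nnWeight a D x i else 0

/-- The posterior probability reweighted by `a`. -/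
def reweightedPosterior (κ : Kernel (Feature d) (Fin M)) (a : Fin M → ℝ) (x : Feature d)
    (m : Fin M) : ℝ :=
  a m * posterior κ x m / ∑ j, a j * posterior κ x j

/-- The part of `expectedPosterior` that has mean zero given the features. -/
def centeredPart (κ : Kernel (Feature d) (Fin M)) (a : Fin M → ℝ) (D : DataSet n d M)
    (x : Feature d) (m : Fin M) : ℝ :=
  ∑ i, ((if (D i).2 = m then 1 else 0) - reweightedPosterior κ a (D i).1 m) * nnWeight a D x i

/-- `Tuple.sort` is stable, so it breaks equal distances by index exactly as `Precedes` does. -/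
lemma precedes_sort_iff (D : DataSet n d M) (x : Feature d) (i j : Fin n) :
    Precedes D x (Tuple.sort (fun i => dist (D i).1 x) i)
      (Tuple.sort (fun i => dist (D i).1 x) j) ↔ i < j := by
  obtain ⟨hmono, hlt⟩ := (Tuple.eq_sort_iff (f := fun i => dist (D i).1 x)).1 rfl
  set σ := Tuple.sort (fun i => dist (D i).1 x)
  constructor
  · intro h
    by_contra hij
    rw [not_lt] at hij
    rcases h with h | ⟨h, h'⟩
    · exact absurd (hmono hij) (not_le.2 h)
    · rcases hij.eq_or_lt with rfl | hij
      · exact lt_irrefl _ h'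
      · exact absurd (hlt _ _ hij h.symm) h'.not_gt
  · intro h
    rcases (hmono h.le).lt_or_eq with h' | h'
    · exact Or.inl h'
    · exact Or.inr ⟨h', hlt _ _ h h'⟩

lemma nnWeight_sort (a : Fin M → ℝ) (D : DataSet n d M) (x : Feature d) (i : Fin n) :
    nnWeight a D x (Tuple.sort (fun i => dist (D i).1 x) i) =
      a (D (Tuple.sort (fun i => dist (D i).1 x) i)).2 *
        ∏ j, if j < i then 1 - a (D (Tuple.sort (fun i => dist (D i).1 x) j)).2 else 1 := by
  rw [nnWeight, ← Equiv.prod_comp (Tuple.sort (fun i => dist (D i).1 x))]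
  simp only [precedes_sort_iff]

lemma measurable_label (i : Fin n) (a : Fin M → ℝ) :
    Measurable fun p : DataSet n d M × Feature d => a (p.1 i).2 :=
  (measurable_of_finite a).comp (by fun_prop)

lemma measurableSet_precedes (j i : Fin n) :
    MeasurableSet {p : DataSet n d M × Feature d | Precedes p.1 p.2 j i} := by
  have h : ∀ k : Fin n, Measurable fun p : DataSet n d M × Feature d => dist (p.1 k).1 p.2 := by
    intro k; fun_prop
  unfold Precedes
  exact (measurableSet_lt (h j) (h i)).union
    ((measurableSet_eq_fun (h j) (h i)).inter (MeasurableSet.const _))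

lemma measurable_nnWeight (a : Fin M → ℝ) (i : Fin n) :
    Measurable fun p : DataSet n d M × Feature d => nnWeight a p.1 p.2 i := by
  classical
  unfold nnWeight
  refine (measurable_label i a).mul (Finset.measurable_prod _ fun j _ => ?_)
  exact Measurable.ite (measurableSet_precedes j i)
    (measurable_const.sub (measurable_label j a)) measurable_const

lemma measurable_expectedPosterior (a : Fin M → ℝ) (m : Fin M) :
    Measurable fun p : DataSet n d M × Feature d => expectedPosterior a p.1 p.2 m := by
  unfold expectedPosterior
  refine Finset.measurable_sum _ fun i _ => Measurable.ite ?_ (measurable_nnWeight a i)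
    measurable_const
  exact (measurableSet_singleton m).preimage
    (f := fun p : DataSet n d M × Feature d => (p.1 i).2) (by fun_prop)

lemma measurable_posterior (κ : Kernel (Feature d) (Fin M)) (m : Fin M) :
    Measurable fun x => posterior κ x m :=
  (κ.measurable_coe (measurableSet_singleton m)).ennreal_toReal

lemma measurable_reweightedPosterior (κ : Kernel (Feature d) (Fin M)) (a : Fin M → ℝ)
    (m : Fin M) : Measurable fun x => reweightedPosterior κ a x m := by
  have := measurable_posterior κ
  unfold reweightedPosterior
  fun_prop

lemma measurable_centeredPart (κ : Kernel (Feature d) (Fin M)) (a : Fin M → ℝ) (x : Feature d)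
    (m : Fin M) : Measurable fun D : DataSet n d M => centeredPart κ a D x m := by
  unfold centeredPart
  refine Finset.measurable_sum _ fun i _ => Measurable.mul (Measurable.sub ?_ ?_) ?_
  · exact Measurable.ite ((measurableSet_singleton m).preimage
      (f := fun p : DataSet n d M => (p i).2) (by fun_prop)) measurable_const measurable_const
  · exact (measurable_reweightedPosterior κ a m).comp (by fun_prop)
  · exact (measurable_nnWeight a i).comp (measurable_id.prodMk measurable_const)

lemma posterior_nonneg (κ : Kernel (Feature d) (Fin M)) (x : Feature d) (m : Fin M) :
    0 ≤ posterior κ x m := measureReal_nonneg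

lemma sum_posterior (κ : Kernel (Feature d) (Fin M)) [IsMarkovKernel κ] (x : Feature d) :
    ∑ m, posterior κ x m = 1 := by
  unfold _root_.posterior
  rw [sum_measureReal_singleton, Finset.coe_univ, probReal_univ]

lemma posterior_le_one (κ : Kernel (Feature d) (Fin M)) [IsMarkovKernel κ] (x : Feature d)
    (m : Fin M) : posterior κ x m ≤ 1 := measureReal_le_one

lemma le_sum_mul_posterior (κ : Kernel (Feature d) (Fin M)) [IsMarkovKernel κ] {a : Fin M → ℝ}
    {a₀ : ℝ} (ha : ∀ l, a₀ ≤ a l) (x : Feature d) : a₀ ≤ ∑ j, a j * posterior κ x j := by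
  calc a₀ = ∑ j, a₀ * posterior κ x j := by rw [← Finset.mul_sum, sum_posterior, mul_one]
    _ ≤ _ := Finset.sum_le_sum fun j _ =>
      mul_le_mul_of_nonneg_right (ha j) (posterior_nonneg κ x j)

lemma reweightedPosterior_mem_Icc (κ : Kernel (Feature d) (Fin M)) {a : Fin M → ℝ}
    (ha : ∀ l, 0 ≤ a l) (x : Feature d) (m : Fin M) :
    reweightedPosterior κ a x m ∈ Set.Icc (0 : ℝ) 1 := by
  have h : ∀ j, 0 ≤ a j * posterior κ x j := fun j => mul_nonneg (ha j) (posterior_nonneg κ x j)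
  refine ⟨div_nonneg (h m) (Finset.sum_nonneg fun j _ => h j), ?_⟩
  exact div_le_one_of_le₀ (Finset.single_le_sum (fun j _ => h j) (Finset.mem_univ m))
    (Finset.sum_nonneg fun j _ => h j)

/-- This dictates the centring: under the posterior, the mean of `a(Y)` on the event `Y = m` is `a m
* η_m`, which is the reweighted posterior times the mean of `a(Y)`. Hence the increments of the
martingale have mean zero. -/
lemma sum_posterior_mul_eq_zero (κ : Kernel (Feature d) (Fin M)) [IsMarkovKernel κ]
    {a : Fin M → ℝ} (ha : ∀ l, 0 < a l) (x : Feature d) (m : Fin M) :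
    ∑ l, posterior κ x l * (((if l = m then 1 else 0) - reweightedPosterior κ a x m) * a l) = 0 := by
  have hA : (∑ j, a j * posterior κ x j) ≠ 0 := by
    intro h0
    rw [Finset.sum_eq_zero_iff_of_nonneg
      fun j _ => mul_nonneg (ha j).le (posterior_nonneg κ x j)] at h0
    have h1 := sum_posterior κ x
    rw [Finset.sum_eq_zero fun j hj => ?_] at h1
    · exact zero_ne_one h1
    · exact (mul_eq_zero.1 (h0 j hj)).resolve_left (ha j).ne'
  have e : ∀ l, posterior κ x l * (((if l = m then 1 else 0) - reweightedPosterior κ a x m) * a l)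
      = (if l = m then a l * posterior κ x l else 0)
        - reweightedPosterior κ a x m * (a l * posterior κ x l) := by
    intro l; split_ifs <;> ring
  simp only [e, Finset.sum_sub_distrib, ← Finset.mul_sum, Finset.sum_ite_eq', Finset.mem_univ,
    if_true]
  rw [reweightedPosterior, div_mul_cancel₀ _ hA, sub_self]

variable (P : Measure (Feature d × Fin M)) [IsProbabilityMeasure P]
  (κ : Kernel (Feature d) (Fin M))

/-- Given the features, the labels are independent, and the order of the points around `x` is fixed.
Listed in that order, the centred part is a discounted martingale to which `sum_ite_discounted_le`
applies; the bound is then integrated over the features. -/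
lemma measure_centeredPart_ge_le [IsMarkovKernel κ] [P.IsCondKernel κ] {a : Fin M → ℝ} {a₀ a₁ t : ℝ} (ha₀ : 0 < a₀)
    (ha : ∀ l, a₀ ≤ a l) (ha' : ∀ l, a l ≤ a₁) (ha₁ : ∀ l, a l ≤ 1) (ht : 0 ≤ t) (x : Feature d)
    (m : Fin M) :
    (Measure.pi fun _ : Fin n => P) {D | t ≤ |centeredPart κ a D x m|} ≤
      ENNReal.ofReal (2 * Real.exp (-t ^ 2 / (2 * (a₁ ^ 2 / a₀)))) := by
  classical
  have hset : MeasurableSet {D : DataSet n d M | t ≤ |centeredPart κ a D x m|} := by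
    have := measurable_centeredPart (n := n) κ a x m
    exact measurableSet_le measurable_const (by fun_prop)
  have hapos : ∀ l, 0 < a l := fun l => ha₀.trans_le (ha l)
  have ha₁pos : 0 < a₁ := (hapos m).trans_le (ha' m)
  have ha₀1 : a₀ ≤ 1 := (ha m).trans (ha₁ m)
  have hmk : ∀ y : Fin n → Fin M, Measurable fun (X : Fin n → Feature d) i => (X i, y i) := by
    intro y; fun_prop
  rw [pi_eq_sum_withDensity P κ, Measure.finsetSum_apply]
  calc _ = ∑ y : Fin n → Fin M, ∫⁻ X : Fin n → Feature d,
        ENNReal.ofReal ((∏ i, posterior κ (X i) (y i)) *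
          (if t ≤ |centeredPart κ a (fun i => (X i, y i)) x m| then 1 else 0))
          ∂(Measure.pi fun _ : Fin n => P.fst) := by
        refine Finset.sum_congr rfl fun y _ => ?_
        rw [Measure.map_apply (hmk y) hset, withDensity_apply _ (hmk y hset),
          ← lintegral_indicator (hmk y hset)]
        refine lintegral_congr fun X => ?_
        simp only [Set.indicator_apply, Set.mem_preimage, Set.mem_ofPred_eq]
        split_ifs with h
        · rw [mul_one, ENNReal.ofReal_prod_of_nonneg fun i _ => posterior_nonneg κ _ _]
          refine Finset.prod_congr rfl fun i _ => ?_
          rw [_root_.posterior, ofReal_measureReal]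
        · simp
    _ = ∫⁻ X : Fin n → Feature d, ∑ y : Fin n → Fin M,
        ENNReal.ofReal ((∏ i, posterior κ (X i) (y i)) *
          (if t ≤ |centeredPart κ a (fun i => (X i, y i)) x m| then 1 else 0))
          ∂(Measure.pi fun _ : Fin n => P.fst) := by
        rw [lintegral_finsetSum]
        intro y _
        refine ENNReal.measurable_ofReal.comp (Measurable.mul ?_ ?_)
        · exact Finset.measurable_prod _ fun i _ =>
            (measurable_posterior κ (y i)).comp (measurable_pi_apply i)
        · exact Measurable.ite (hmk y hset) measurable_const measurable_const
    _ ≤ ∫⁻ X : Fin n → Feature d, ENNReal.ofReal (2 * Real.exp (-t ^ 2 / (2 * (a₁ ^ 2 / a₀))))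
          ∂(Measure.pi fun _ : Fin n => P.fst) := by
        refine lintegral_mono fun X => ?_
        dsimp only
        rw [← ENNReal.ofReal_sum_of_nonneg fun y _ => mul_nonneg
          (Finset.prod_nonneg fun i _ => posterior_nonneg κ _ _) (by split_ifs <;> norm_num)]
        apply ENNReal.ofReal_le_ofReal
        -- The order depends on the features only, so the sum over label vectors may be reindexed by
        -- it.
        set σ := Tuple.sort (fun i => dist (X i) x)
        rw [← (Equiv.arrowCongr σ (Equiv.refl (Fin M))).sum_comp]
        -- The discounts are at most `1 - a₀` and the increments at most `a₁`; `V = a₁ ^ 2 / a₀`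
        -- bounds the resulting geometric sum of squares.
        have key := sum_ite_discounted_le (n := n) (θ := fun l => 1 - a l) (r := 1 - a₀) (c := a₁)
          (V := a₁ ^ 2 / a₀) ht
          (fun l => abs_le.2 ⟨by linarith [ha₁ l, ha l], by linarith [ha l]⟩)
          (by positivity) ?_ (p := fun i l => posterior κ (X (σ i)) l)
          (v := fun i l => ((if l = m then 1 else 0) - reweightedPosterior κ a (X (σ i)) m) * a l)
          (fun i l => posterior_nonneg κ _ _) (fun i => sum_posterior κ _)
          (fun i => sum_posterior_mul_eq_zero κ hapos _ m) ?_
        · refine le_trans (le_of_eq (Finset.sum_congr rfl fun y _ => ?_)) key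
          congr 1
          · rw [← Equiv.prod_comp σ]
            simp [Equiv.arrowCongr]
          · congr 3
            rw [centeredPart, ← Equiv.sum_comp σ]
            refine Finset.sum_congr rfl fun i _ => ?_
            have := nnWeight_sort a
              (fun i => (X i, Equiv.arrowCongr σ (Equiv.refl (Fin M)) y i)) x i
            change nnWeight a _ x (σ i) = a (_, Equiv.arrowCongr σ (Equiv.refl (Fin M)) y (σ i)).2 *
              ∏ j, (if j < i then 1 - a (Equiv.arrowCongr σ (Equiv.refl (Fin M)) y (σ j))
                else 1) at this
            rw [this]
            simp only [Equiv.arrowCongr_apply, Function.comp_apply, Equiv.symm_apply_apply,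
              Equiv.refl_apply]
            ring
        · have : a₁ ^ 2 + (1 - a₀) ^ 2 * (a₁ ^ 2 / a₀) = a₁ ^ 2 / a₀ - a₁ ^ 2 * (1 - a₀) := by
            field_simp; ring
          rw [this]
          have := mul_nonneg (sq_nonneg a₁) (sub_nonneg.2 ha₀1)
          linarith
        · intro i l
          have hq := reweightedPosterior_mem_Icc κ (fun l => (hapos l).le) (X (σ i)) m
          rw [abs_mul, abs_of_pos (hapos l)]
          refine (mul_le_of_le_one_left (hapos l).le (abs_le.2 ?_)).trans (ha' l)
          split_ifs
          · exact ⟨by linarith [hq.2], by linarith [hq.1]⟩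
          · exact ⟨by linarith [hq.2], by linarith [hq.1]⟩
    _ = _ := by simp

open Classical in
-- After removal of the centred part, the expected vote is a discounted average of `q` along the
-- points ordered by distance. The points within `R` form an initial segment, so
-- `abs_sum_discounted_sub_le` applies; the final product bounds the chance that none of them is
-- accepted.
lemma abs_expectedPosterior_sub_le {a : Fin M → ℝ} {a₀ R e : ℝ}
    (ha₀ : 0 ≤ a₀) (ha : ∀ l, a₀ ≤ a l) (ha₁ : ∀ l, a l ≤ 1) (D : DataSet n d M) (x : Feature d)
    (m : Fin M) (he : 0 ≤ e) (h : ∀ i, dist (D i).1 x ≤ R →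
      |reweightedPosterior κ a (D i).1 m - reweightedPosterior κ a x m| ≤ e) :
    |expectedPosterior a D x m - reweightedPosterior κ a x m| ≤ |centeredPart κ a D x m| + (e +
      ∏ i, if dist (D i).1 x ≤ R then 1 - a₀ else 1) := by
  set σ := Tuple.sort (fun i => dist (D i).1 x) with hσ
  have ha0 : ∀ l, 0 ≤ a l := fun l => ha₀.trans (ha l)
  have hsort := nnWeight_sort a D x
  rw [← hσ] at hsort
  have hmono : Monotone ((fun i => dist (D i).1 x) ∘ σ) := Tuple.monotone_sort _
  have key := abs_sum_discounted_sub_le (g := fun i => a (D (σ i)).2)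
    (q := fun i => reweightedPosterior κ a (D (σ i)).1 m) (q₀ := reweightedPosterior κ a x m)
    (e := e) (T := Finset.univ.filter fun i => dist (D (σ i)).1 x ≤ R)
    (fun i => ⟨ha0 _, ha₁ _⟩) (fun i => reweightedPosterior_mem_Icc κ ha0 _ m)
    (reweightedPosterior_mem_Icc κ ha0 _ m) he
    (fun i hi j hj => by
      simp only [Finset.mem_filter, Finset.mem_univ, true_and] at hi ⊢
      exact (hmono hj.le).trans hi)
    (fun i hi => h _ (by simpa using hi))
  have e1 : expectedPosterior a D x m = centeredPart κ a D x m
      + ∑ i, nnWeight a D x (σ i) * reweightedPosterior κ a (D (σ i)).1 m := by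
    rw [Equiv.sum_comp σ fun i => nnWeight a D x i * reweightedPosterior κ a (D i).1 m,
      expectedPosterior, centeredPart, ← Finset.sum_add_distrib]
    refine Finset.sum_congr rfl fun i _ => ?_
    split_ifs <;> ring
  have e2 : ∏ i ∈ Finset.univ.filter (fun i => dist (D (σ i)).1 x ≤ R), (1 - a (D (σ i)).2)
      ≤ ∏ i, if dist (D i).1 x ≤ R then 1 - a₀ else 1 := by
    rw [Finset.prod_filter, ← Equiv.prod_comp σ fun i => if dist (D i).1 x ≤ R then 1 - a₀ else 1]
    refine Finset.prod_le_prod (fun i _ => ?_) fun i _ => ?_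
    · split_ifs
      · linarith [ha₁ (D (σ i)).2]
      · norm_num
    · split_ifs
      · linarith [ha (D (σ i)).2]
      · norm_num
  simp only [hsort] at e1
  rw [e1, add_sub_assoc]
  refine (abs_add_le _ _).trans (add_le_add_right (key.trans ?_) _)
  linarith

open Classical in
-- Markov's inequality: by independence the product has mean `(1 - a₀ * P(ball)) ^ n`, at most `exp
-- (-(n * a₀ * p))`.
lemma measure_prod_ite_ge_le {a₀ R p ε : ℝ} (ha₀ : 0 ≤ a₀) (ha₀1 : a₀ ≤ 1) (x : Feature d)
    (hp : p ≤ P.real {z | dist z.1 x ≤ R}) (hε : 0 < ε) :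
    (Measure.pi fun _ : Fin n => P) {D | ε ≤ ∏ i, if dist (D i).1 x ≤ R then 1 - a₀ else 1}
      ≤ ENNReal.ofReal (Real.exp (-(n * (a₀ * p))) / ε) := by
  have hball : MeasurableSet {z : Feature d × Fin M | dist z.1 x ≤ R} :=
    measurableSet_le (by fun_prop) measurable_const
  set f : Feature d × Fin M → ℝ≥0∞ := fun z => if dist z.1 x ≤ R then ENNReal.ofReal (1 - a₀) else 1
  have hf : Measurable f := Measurable.ite hball measurable_const measurable_const
  have hint : ∫⁻ z, f z ∂P ≤ ENNReal.ofReal (Real.exp (-(a₀ * p))) := by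
    have e1 : ∫⁻ z, f z ∂P = ENNReal.ofReal (1 - a₀ * P.real {z | dist z.1 x ≤ R}) := by
      have hfs : f = fun z => {z : Feature d × Fin M | dist z.1 x ≤ R}.indicator
          (fun _ => ENNReal.ofReal (1 - a₀)) z +
          {z : Feature d × Fin M | dist z.1 x ≤ R}ᶜ.indicator (fun _ => 1) z := by
        ext z
        by_cases h : dist z.1 x ≤ R <;> simp [f, h]
      rw [hfs, lintegral_add_left (measurable_const.indicator hball),
        lintegral_indicator_const hball, lintegral_indicator_const hball.compl,
        ← ofReal_measureReal, ← ofReal_measureReal, one_mul, probReal_compl_eq_one_sub hball,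
        ← ENNReal.ofReal_mul (by linarith), ← ENNReal.ofReal_add
        (mul_nonneg (by linarith) measureReal_nonneg) (by linarith [measureReal_le_one (μ := P) (s := {z | dist z.1 x ≤ R})])]
      congr 1; ring
    rw [e1]
    apply ENNReal.ofReal_le_ofReal
    have := Real.add_one_le_exp (-(a₀ * p))
    have := mul_le_mul_of_nonneg_left hp ha₀
    linarith
  have hmk := mul_meas_ge_le_lintegral (μ := Measure.pi fun _ : Fin n => P)
    (f := fun D => ∏ i, f (D i))
    (Finset.measurable_prod _ fun i _ => hf.comp (measurable_pi_apply i)) (ENNReal.ofReal ε)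
  rw [lintegral_pi_prod P fun _ => hf] at hmk
  rw [ENNReal.ofReal_div_of_pos hε, ENNReal.le_div_iff_mul_le (by simp [hε]) (by simp), mul_comm]
  have hset : {D : DataSet n d M | ε ≤ ∏ i, if dist (D i).1 x ≤ R then 1 - a₀ else 1}
      ⊆ {D | ENNReal.ofReal ε ≤ ∏ i, f (D i)} := by
    intro D hD
    have := ENNReal.ofReal_le_ofReal hD
    rw [ENNReal.ofReal_prod_of_nonneg fun i _ => by split_ifs <;> linarith] at this
    refine this.trans (le_of_eq (Finset.prod_congr rfl fun i _ => ?_))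
    simp only [f]
    split_ifs <;> simp
  refine (mul_le_mul_right (measure_mono hset) _).trans (hmk.trans ?_)
  rw [Finset.prod_const, Finset.card_univ, Fintype.card_fin]
  refine (pow_le_pow_left' hint n).trans (le_of_eq ?_)
  rw [← ENNReal.ofReal_pow (Real.exp_pos _).le, ← Real.exp_nat_mul]
  congr 2; ring

end Weights

/-! ### Mass of Euclidean balls in the cube -/

section Cube

variable {d : ℕ}

lemma measurableSet_unitCube : MeasurableSet (unitCube d) := by
  have : unitCube d = ⋂ i, {x | x i ∈ Set.Icc (0 : ℝ) 1} := by ext; simp [unitCube]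
  rw [this]
  exact MeasurableSet.iInter fun i => measurableSet_Icc.preimage (by fun_prop)

lemma ofReal_le_volume_Icc_inter {u δ : ℝ} (hu : u ∈ Set.Icc (0 : ℝ) 1) (hδ : δ ∈ Set.Icc (0 : ℝ) 1) :
    ENNReal.ofReal δ ≤ volume (Set.Icc (max 0 (u - δ)) (min 1 (u + δ))) := by
  rw [Real.volume_Icc]
  apply ENNReal.ofReal_le_ofReal
  obtain ⟨h1, h2⟩ := hu
  obtain ⟨h3, h4⟩ := hδ
  rcases max_cases 0 (u - δ) with h | h <;> rcases min_cases 1 (u + δ) with h' | h' <;> linarith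

/-- The ball contains the sup-norm cube of radius `δ` around `x`. In each coordinate this cube keeps
length at least `δ` inside `[0, 1]`, even when `x` is at a corner. -/
lemma pow_le_volume_closedBall_inter_unitCube {x : Feature d} (hx : x ∈ unitCube d) {δ : ℝ}
    (hδ : δ ∈ Set.Icc (0 : ℝ) 1) :
    ENNReal.ofReal (δ ^ d) ≤ volume ({z : Feature d | dist z x ≤ √d * δ} ∩ unitCube d) := by
  set Q : Set (Fin d → ℝ) := Set.univ.pi fun i => Set.Icc (max 0 (x i - δ)) (min 1 (x i + δ))
  have hQ : MeasurableSet Q := MeasurableSet.univ_pi fun _ => measurableSet_Icc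
  have h1 : volume (WithLp.ofLp ⁻¹' Q : Set (Feature d)) = volume Q :=
    (PiLp.volume_preserving_ofLp (Fin d)).measure_preimage hQ.nullMeasurableSet
  have h2 : ENNReal.ofReal (δ ^ d) ≤ volume Q := by
    rw [volume_pi_pi, ENNReal.ofReal_pow hδ.1]
    calc ENNReal.ofReal δ ^ d = ∏ _i : Fin d, ENNReal.ofReal δ := by simp
      _ ≤ _ := Finset.prod_le_prod' fun i _ => ofReal_le_volume_Icc_inter (hx i) hδ
  refine h2.trans (h1 ▸ measure_mono fun z hz => ?_)
  have hz' : ∀ i, z i ∈ Set.Icc (max 0 (x i - δ)) (min 1 (x i + δ)) := fun i => hz i (Set.mem_univ i)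
  constructor
  · change dist z x ≤ √d * δ
    rw [EuclideanSpace.dist_eq]
    apply Real.sqrt_le_iff.2 ⟨mul_nonneg (Real.sqrt_nonneg _) hδ.1, ?_⟩
    rw [mul_pow, Real.sq_sqrt (Nat.cast_nonneg d)]
    calc ∑ i, dist (z i) (x i) ^ 2 ≤ ∑ _i : Fin d, δ ^ 2 := by
          refine Finset.sum_le_sum fun i _ => ?_
          rw [Real.dist_eq]
          refine pow_le_pow_left₀ (abs_nonneg _) (abs_le.2 ?_) 2
          have := hz' i
          simp only [Set.mem_Icc, max_le_iff, le_min_iff] at this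
          constructor <;> linarith
      _ = d * δ ^ 2 := by simp
  · intro i
    have := hz' i
    simp only [Set.mem_Icc, max_le_iff, le_min_iff] at this
    exact ⟨this.1.1, this.2.1⟩

end Cube

/-! ### The acceptance variables given the data -/

section Bagging

variable {n d M : ℕ}

instance (D : DataSet n d M) (s : ℝ) : IsProbabilityMeasure (roundLaw D s) := by
  unfold roundLaw; infer_instance

instance (D : DataSet n d M) (s : ℝ) (B : ℕ) : IsProbabilityMeasure (baggingLaw D s B) := by
  unfold baggingLaw; infer_instance

lemma not_precedes_self (D : DataSet n d M) (x : Feature d) (i : Fin n) : ¬ Precedes D x i i := by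
  simp [Precedes]

lemma precedes_or_precedes (D : DataSet n d M) (x : Feature d) {i j : Fin n} (h : i ≠ j) :
    Precedes D x i j ∨ Precedes D x j i := by
  unfold Precedes
  rcases lt_trichotomy (dist (D i).1 x) (dist (D j).1 x) with h1 | h1 | h1
  · exact Or.inl (Or.inl h1)
  · rcases lt_or_gt_of_ne h with h2 | h2
    · exact Or.inl (Or.inr ⟨h1, h2⟩)
    · exact Or.inr (Or.inr ⟨h1.symm, h2⟩)
  · exact Or.inr (Or.inl h1)

/-- `i` is the nearest accepted data point. -/
def IsNearestAccepted (D : DataSet n d M) (x : Feature d) (z : Fin n → Bool) (i : Fin n) : Prop :=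
  z i = true ∧ ∀ j, Precedes D x j i → z j = false

lemma nnRank_lt_one_iff (D : DataSet n d M) (z : Fin n → Bool) (x : Feature d) (i : Fin n) :
    nnRank D z x i < 1 ↔ ∀ j, Precedes D x j i → z j = false := by
  classical
  rw [Nat.lt_one_iff, nnRank, Finset.card_eq_zero, Finset.filter_eq_empty_iff]
  simp only [Finset.mem_univ, forall_const, not_and]
  refine forall_congr' fun j => ⟨fun h hj => ?_, fun h hz hj => ?_⟩
  · by_contra hz
    exact h (by simpa using hz) hj
  · simp [h hj] at hz

open Classical in
lemma roundPosterior_one_eq (D : DataSet n d M) (z : Fin n → Bool) (x : Feature d) (m : Fin M) :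
    roundPosterior 1 D z x m =
      ∑ i, if (D i).2 = m then (if IsNearestAccepted D x z i then (1 : ℝ) else 0) else 0 := by
  rw [roundPosterior, Nat.cast_one, div_one, one_mul, Finset.card_filter]
  push_cast
  refine Finset.sum_congr rfl fun i _ => ?_
  have h := nnRank_lt_one_iff D z x i
  rw [← ite_and]
  refine if_congr ?_ rfl rfl
  rw [IsNearestAccepted, h]
  tauto

/-- `Precedes` compares any two distinct points, so at most one accepted point is nearest. -/
lemma roundPosterior_mem_Icc (D : DataSet n d M) (z : Fin n → Bool) (x : Feature d) (m : Fin M) :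
    roundPosterior 1 D z x m ∈ Set.Icc (0 : ℝ) 1 := by
  classical
  rw [roundPosterior, Nat.cast_one, div_one, one_mul]
  refine ⟨Nat.cast_nonneg _, ?_⟩
  rw [Nat.cast_le_one, Finset.card_le_one]
  intro i hi j hj
  simp only [Finset.mem_filter, Finset.mem_univ, true_and, nnRank_lt_one_iff] at hi hj
  by_contra hij
  rcases precedes_or_precedes D x hij with h | h
  · have := hj.2.1 i h
    simp [hi.1] at this
  · have := hi.2.1 j h
    simp [hj.1] at this

lemma measurableSet_isNearestAccepted (D : DataSet n d M) (z : Fin n → Bool) (i : Fin n) :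
    MeasurableSet {x | IsNearestAccepted D x z i} := by
  have : {x | IsNearestAccepted D x z i} =
      {x | z i = true} ∩ ⋂ j, ({x | Precedes D x j i}ᶜ ∪ {x | z j = false}) := by
    ext x
    simp only [IsNearestAccepted, Set.mem_ofPred_eq, Set.mem_inter_iff, Set.mem_iInter,
      Set.mem_union, Set.mem_compl_iff]
    refine and_congr_right fun _ => forall_congr' fun j => by tauto
  rw [this]
  refine (MeasurableSet.const _).inter (MeasurableSet.iInter fun j => ?_)
  refine (MeasurableSet.compl ?_).union (MeasurableSet.const _)
  exact (measurableSet_precedes j i).preimage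
    (f := fun x => (D, x)) (measurable_const.prodMk measurable_id)

lemma measurable_roundPosterior (D : DataSet n d M) (z : Fin n → Bool) (m : Fin M) :
    Measurable fun x => roundPosterior 1 D z x m := by
  classical
  simp only [roundPosterior_one_eq]
  refine Finset.measurable_sum _ fun i _ => ?_
  split_ifs
  · exact Measurable.ite (measurableSet_isNearestAccepted D z i) measurable_const measurable_const
  · exact measurable_const

lemma measurable_baggedPosterior (D : DataSet n d M) {B : ℕ} (m : Fin M) :
    Measurable fun p : (Fin B → Fin n → Bool) × Feature d => baggedPosterior 1 D p.1 p.2 m := by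
  -- There are finitely many acceptance patterns, so measurability in `x` for each pattern suffices.
  refine measurable_from_prod_countable_right fun Z => ?_
  unfold baggedPosterior
  exact measurable_const.mul (Finset.measurable_sum _ fun b _ => measurable_roundPosterior D (Z b) m)

/-- The event is a box: `true` at `i`, `false` at the points preceding `i`, no constraint elsewhere.
Its product measure is therefore the weight. -/
lemma roundLaw_isNearestAccepted (D : DataSet n d M) {s : ℝ}
    (hs : ∀ l, acceptProb D s l ∈ Set.Icc (0 : ℝ) 1) (x : Feature d) (i : Fin n) :
    (roundLaw D s).real {z | IsNearestAccepted D x z i} = nnWeight (acceptProb D s) D x i := by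
  classical
  have hset : {z | IsNearestAccepted D x z i} = Set.univ.pi fun k : Fin n =>
      if k = i then {true} else if Precedes D x k i then {false} else (Set.univ : Set Bool) := by
    ext z
    simp only [IsNearestAccepted, Set.mem_ofPred_eq, Set.mem_univ_pi]
    constructor
    · rintro ⟨h1, h2⟩ k
      split_ifs with hk hp
      · rw [hk]; exact h1
      · exact h2 k hp
      · trivial
    · intro h
      refine ⟨by simpa using h i, fun j hj => ?_⟩
      have hji : j ≠ i := fun h => not_precedes_self D x i (h ▸ hj)
      simpa [hji, hj] using h j
  have hproj : ∀ l, ((Set.projIcc (0 : ℝ) 1 zero_le_one (acceptProb D s l)) : ℝ)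
      = acceptProb D s l := fun l => by rw [Set.projIcc_of_mem _ (hs l)]
  rw [hset, roundLaw, measureReal_def, Measure.pi_pi, ENNReal.toReal_prod]
  have : ∀ k : Fin n, ((bernoulliMeasure true false
      (Set.projIcc (0 : ℝ) 1 zero_le_one (acceptProb D s (D k).2)))
      (if k = i then {true} else if Precedes D x k i then {false} else (Set.univ : Set Bool))).toReal
      = (if k = i then acceptProb D s (D i).2 else 1) *
        (if Precedes D x k i then 1 - acceptProb D s (D k).2 else 1) := by
    intro k
    rw [← measureReal_def]
    by_cases hk : k = i
    · subst hk
      rw [if_pos rfl, if_pos rfl, if_neg (not_precedes_self D x k), mul_one,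
        bernoulliMeasure_real_apply_of_mem_of_notMem _ (measurableSet_singleton _) (by simp)
          (by simp)]
      exact hproj _
    · rw [if_neg hk, if_neg hk, one_mul]
      split_ifs
      · rw [bernoulliMeasure_real_apply_of_notMem_of_mem _ (measurableSet_singleton _) (by simp)
          (by simp)]
        simp [hproj]
      · simp
  rw [Finset.prod_congr rfl fun k _ => this k, Finset.prod_mul_distrib, Finset.prod_ite_eq',
    if_pos (Finset.mem_univ i), nnWeight]

lemma integral_roundPosterior (D : DataSet n d M) {s : ℝ}
    (hs : ∀ l, acceptProb D s l ∈ Set.Icc (0 : ℝ) 1) (x : Feature d) (m : Fin M) :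
    ∫ z, roundPosterior 1 D z x m ∂(roundLaw D s) =
      expectedPosterior (acceptProb D s) D x m := by
  classical
  simp only [roundPosterior_one_eq]
  rw [integral_finsetSum _ fun i _ => Integrable.of_finite, expectedPosterior]
  refine Finset.sum_congr rfl fun i _ => ?_
  split_ifs
  · rw [← roundLaw_isNearestAccepted D hs]
    have := integral_indicator_one (μ := roundLaw D s) (s := {z | IsNearestAccepted D x z i})
      (Set.toFinite _).measurableSet
    rw [← this]
    refine integral_congr_ae (Filter.Eventually.of_forall fun z => ?_)
    simp [Set.indicator_apply]
  · simp

/-- Hoeffding's inequality over the rounds at each `x` and a union over the labels, integrated over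
`x` by `measure_section_gt_le`. -/
lemma baggingLaw_deviation_le (D : DataSet n d M) {s : ℝ}
    (hs : ∀ l, acceptProb D s l ∈ Set.Icc (0 : ℝ) 1) {B : ℕ} (hB : 0 < B)
    (μ : Measure (Feature d)) [IsProbabilityMeasure μ] {t τ : ℝ} (ht : 0 ≤ t) (hτ : 0 < τ) :
    baggingLaw D s B {Z | ENNReal.ofReal τ ≤ μ {x | ∃ m, t ≤
      |baggedPosterior 1 D Z x m - expectedPosterior (acceptProb D s) D x m|}} ≤
      ENNReal.ofReal (M * (2 * Real.exp (-2 * B * t ^ 2)) / τ) := by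
  have hA : MeasurableSet {p : (Fin B → Fin n → Bool) × Feature d | ∃ m, t ≤
      |baggedPosterior 1 D p.1 p.2 m - expectedPosterior (acceptProb D s) D p.2 m|} := by
    simp only [Set.ofPred_exists]
    refine MeasurableSet.iUnion fun m => measurableSet_le measurable_const ?_
    have h1 := measurable_baggedPosterior D (B := B) m
    have h2 : Measurable fun p : (Fin B → Fin n → Bool) × Feature d =>
      expectedPosterior (acceptProb D s) D p.2 m :=
      (measurable_expectedPosterior (acceptProb D s) m).comp
        (measurable_const.prodMk measurable_snd)
    exact (continuous_abs.measurable).comp (h1.sub h2)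
  refine measure_section_gt_le (baggingLaw D s B) μ hA hτ (Filter.Eventually.of_forall fun x => ?_)
  have hsub : {Z : Fin B → Fin n → Bool | (Z, x) ∈ {p : (Fin B → Fin n → Bool) × Feature d | ∃ m,
      t ≤ |baggedPosterior 1 D p.1 p.2 m - expectedPosterior (acceptProb D s) D p.2 m|}} ⊆
      ⋃ m, {Z : Fin B → Fin n → Bool | B * t ≤ |∑ b, roundPosterior 1 D (Z b) x m
        - B * ∫ z, roundPosterior 1 D z x m ∂(roundLaw D s)|} := by
    rintro Z ⟨m, hm⟩
    refine Set.mem_iUnion.2 ⟨m, ?_⟩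
    have hB' : (0 : ℝ) < B := by exact_mod_cast hB
    rw [Set.mem_ofPred_eq, integral_roundPosterior D hs]
    simp only [baggedPosterior] at hm
    calc B * t ≤ B * |1 / (B : ℝ) * ∑ b, roundPosterior 1 D (Z b) x m
          - expectedPosterior (acceptProb D s) D x m| := by gcongr
      _ = |B * (1 / (B : ℝ) * ∑ b, roundPosterior 1 D (Z b) x m
          - expectedPosterior (acceptProb D s) D x m)| := by rw [abs_mul, abs_of_pos hB']
      _ = _ := by congr 1; field_simp
  refine (measure_mono hsub).trans ((measure_iUnion_fintype_le _ _).trans ?_)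
  calc _ ≤ ∑ _m : Fin M, ENNReal.ofReal (2 * Real.exp (-2 * B * t ^ 2)) :=
        Finset.sum_le_sum fun m _ => hoeffding_pi (roundLaw D s) (measurable_of_finite _)
          (fun z => roundPosterior_mem_Icc D z x m) B ht
    _ = _ := by
      rw [← ENNReal.ofReal_sum_of_nonneg fun _ _ => by positivity]
      simp

end Bagging

/-! ### From accuracy of the posterior estimate to AM-regret -/

section Regret

variable {d M : ℕ}

/-- Since `k` is not a maximiser, `v k` is at most the second largest entry, while the largest entry
is at most `v k + t`. -/
lemma abs_kthLargest_sub_le (hM : 2 ≤ M) {v : Fin M → ℝ} {k m : Fin M} {t : ℝ} (hkm : v k < v m)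
    (h : ∀ l, v l ≤ v k + t) :
    |kthLargest v ⟨0, by omega⟩ - kthLargest v ⟨1, by omega⟩| ≤ t := by
  have hmono : Monotone (v ∘ Tuple.sort v) := Tuple.monotone_sort v
  set σ := Tuple.sort v with hσ
  have h01 : kthLargest v ⟨1, by omega⟩ ≤ kthLargest v ⟨0, by omega⟩ := by
    apply hmono
    rw [Fin.rev_le_rev, Fin.mk_le_mk]
    omega
  have hk : v k ≤ kthLargest v ⟨1, by omega⟩ := by
    obtain ⟨i, rfl⟩ := σ.surjective k
    obtain ⟨j, rfl⟩ := σ.surjective m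
    apply hmono
    have hij : i < j := by
      by_contra hij
      exact absurd (hmono (not_lt.1 hij)) (not_le.2 hkm)
    rw [Fin.le_def, Fin.val_rev]
    have := Fin.lt_def.1 hij
    have := j.2
    simp only
    omega
  rw [abs_of_nonneg (by linarith)]
  have := h (σ (Fin.rev ⟨0, by omega⟩))
  have e : kthLargest v ⟨0, by omega⟩ = v (σ (Fin.rev ⟨0, by omega⟩)) := rfl
  linarith

variable (P : Measure (Feature d × Fin M)) (κ : Kernel (Feature d) (Fin M))

lemma measurable_posterior_div_comp {f : Feature d → Fin M} (hf : Measurable f) :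
    Measurable fun x => _root_.posterior κ x (f x) / classProb P (f x) := by
  have h : Measurable fun q : Feature d × Fin M => _root_.posterior κ q.1 q.2 / classProb P q.2 :=
    measurable_from_prod_countable_left fun m =>
      (measurable_posterior κ m).div_const (classProb P m)
  exact h.comp (measurable_id.prodMk hf)

variable [IsMarkovKernel κ]

lemma posterior_div_mem_Icc {p₀ : ℝ} (hp₀ : 0 < p₀) (hp : ∀ m, p₀ ≤ classProb P m) (x : Feature d)
    (m : Fin M) : _root_.posterior κ x m / classProb P m ∈ Set.Icc 0 (1 / p₀) :=
  ⟨div_nonneg (posterior_nonneg κ x m) (hp₀.le.trans (hp m)),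
    div_le_div₀ zero_le_one (posterior_le_one κ x m) hp₀ (hp m)⟩

lemma sum_posterior_div_mem_Icc [IsProbabilityMeasure P] {p₀ : ℝ} (hp₀ : 0 < p₀) (hp : ∀ m, p₀ ≤ classProb P m)
    (x : Feature d) : ∑ m, _root_.posterior κ x m / classProb P m ∈ Set.Icc 1 (1 / p₀) := by
  constructor
  · rw [← sum_posterior κ x]
    refine Finset.sum_le_sum fun m _ => ?_
    rw [le_div_iff₀ (hp₀.trans_le (hp m))]
    exact mul_le_of_le_one_right (posterior_nonneg κ x m) measureReal_le_one
  · rw [← sum_posterior κ x, Finset.sum_div]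
    exact Finset.sum_le_sum fun m _ =>
      div_le_div_of_nonneg_left (posterior_nonneg κ x m) hp₀ (hp m)

/-- The recall of class `m` is the integral of `η_m / π_m` over the region where `f` predicts `m`,
and these regions partition the space. The regret thus becomes an integral of pointwise losses. -/
lemma amRecall_eq_integral [IsProbabilityMeasure P] [P.IsCondKernel κ] {p₀ : ℝ} (hp₀ : 0 < p₀)
    (hp : ∀ m, p₀ ≤ classProb P m) {f : Feature d → Fin M} (hf : Measurable f) :
    amRecall P f = (1 / (M : ℝ)) *
      ∫ p, _root_.posterior κ p.1 (f p.1) / classProb P (f p.1) ∂P := by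
  have hfm : ∀ m, MeasurableSet (f ⁻¹' {m}) := fun m => hf (measurableSet_singleton m)
  have hrec : ∀ m, classRecall P f m = ∫ x, (f ⁻¹' {m}).indicator
      (fun x => _root_.posterior κ x m / classProb P m) x ∂P.fst := by
    intro m
    have hYm : MeasurableSet {p : Feature d × Fin M | p.2 = m} :=
      (measurableSet_singleton m).preimage measurable_snd
    have e1 : P ({p | p.2 = m} ∩ {p | f p.1 = m}) = ∫⁻ x in f ⁻¹' {m}, κ x {m} ∂P.fst := by
      have e2 : ({p | p.2 = m} ∩ {p | f p.1 = m} : Set (Feature d × Fin M))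
          = (f ⁻¹' {m}) ×ˢ {m} := by
        ext p; simp [and_comm]
      conv_lhs => rw [e2, ← P.disintegrate κ]
      exact Measure.compProd_apply_prod (hfm m) (measurableSet_singleton m)
    rw [classRecall, measureReal_def, cond_apply hYm, e1, ENNReal.toReal_mul,
      integral_indicator (hfm m), integral_div, ENNReal.toReal_inv, ← measureReal_def,
      div_eq_inv_mul]
    congr 1
    unfold _root_.posterior
    simp only [measureReal_def]
    rw [integral_toReal (κ.measurable_coe (measurableSet_singleton m)).aemeasurable
      (Filter.Eventually.of_forall fun x => measure_lt_top _ _)]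
  rw [amRecall]
  congr 1
  simp only [hrec]
  rw [← integral_finsetSum]
  · have := integral_map (μ := P) (φ := Prod.fst)
      (f := fun x => _root_.posterior κ x (f x) / classProb P (f x)) measurable_fst.aemeasurable
      (measurable_posterior_div_comp P κ hf).aestronglyMeasurable
    rw [← this]
    refine integral_congr_ae (Filter.Eventually.of_forall fun x => ?_)
    dsimp only
    rw [Finset.sum_eq_single (f x)]
    · simp
    · intro m _ hm
      rw [Set.indicator_of_notMem]
      exact fun h => hm h.symm
    · simp
  · intro m _
    refine Integrable.indicator ?_ (hfm m)
    refine Integrable.of_bound ((measurable_posterior κ m).div_const _).aestronglyMeasurable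
      (1 / p₀) (Filter.Eventually.of_forall fun x => ?_)
    have := posterior_div_mem_Icc P κ hp₀ hp x m
    rw [Real.norm_eq_abs, abs_of_nonneg this.1]
    exact this.2

/-- The margin bound on the regret of a classifier that is nearly optimal outside of a small set. -/
lemma amRegret_le [IsProbabilityMeasure P] [P.IsCondKernel κ] (hM : 2 ≤ M) {p₀ β cβ t τ : ℝ} (hp₀ : 0 < p₀)
    (hp : ∀ m, p₀ ≤ classProb P m) (hmargin : MarginCondition P κ hM β cβ) (ht : 0 < t)
    {f : Feature d → Fin M} (hf : Measurable f) {G : Set (Feature d)} (hG : MeasurableSet G)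
    (hGτ : (P.map Prod.fst).real G ≤ τ)
    (hgood : ∀ᵐ p ∂P, p.1 ∉ G →
      ∀ m, weightedPosterior P κ p.1 m ≤ weightedPosterior P κ p.1 (f p.1) + t) :
    amRegret P f ≤ (τ + t * (cβ * t ^ β)) / p₀ := by
  classical
  set v : Feature d → Fin M → ℝ := fun x m => _root_.posterior κ x m / classProb P m
  set A : Set (Feature d × Fin M) := {p | |kthLargest (weightedPosterior P κ p.1) ⟨0, by omega⟩
      - kthLargest (weightedPosterior P κ p.1) ⟨1, by omega⟩| ≤ t}
  -- A measurable hull has the same measure and avoids proving the margin event measurable.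
  set A' := toMeasurable P A
  have hA' : P.real A' ≤ cβ * t ^ β := by
    have := hmargin t ht
    rwa [measureReal_def, ← measure_toMeasurable, ← measureReal_def] at this
  have hA'm : MeasurableSet A' := measurableSet_toMeasurable P A
  have hG'm : MeasurableSet (Prod.fst ⁻¹' G : Set (Feature d × Fin M)) := hG.preimage measurable_fst
  have hG' : P.real (Prod.fst ⁻¹' G) ≤ τ := by
    rwa [map_measureReal_apply measurable_fst hG] at hGτ
  have hv : ∀ {g : Feature d → Fin M}, Measurable g → Integrable (fun p => v p.1 (g p.1)) P := by
    intro g hg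
    refine Integrable.of_bound ((measurable_posterior_div_comp P κ hg).comp
      measurable_fst).aestronglyMeasurable (1 / p₀) (Filter.Eventually.of_forall fun p => ?_)
    have := posterior_div_mem_Icc P κ hp₀ hp p.1 (g p.1)
    rw [Real.norm_eq_abs, abs_of_nonneg this.1]
    exact this.2
  have hM' : (1 : ℝ) ≤ M := by exact_mod_cast (by omega : 1 ≤ M)
  rw [amRegret, sub_le_iff_le_add]
  apply csSup_le
  · exact Set.Nonempty.image _ ⟨fun _ => ⟨0, by omega⟩,
      (measurable_const : Measurable fun _ : Feature d => (⟨0, by omega⟩ : Fin M))⟩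
  rintro _ ⟨g, hg, rfl⟩
  -- On `G` the loss is at most `1 / p₀`. Off `G` a positive loss forces the margin event, and is at
  -- most `t * ∑ η_j / π_j ≤ t / p₀`.
  have hpt : ∀ᵐ p ∂P, v p.1 (g p.1) - v p.1 (f p.1) ≤ (1 / p₀) *
      ((Prod.fst ⁻¹' G).indicator (fun _ => (1 : ℝ)) p + t * A'.indicator (fun _ => (1 : ℝ)) p) := by
    filter_upwards [hgood] with p hpg
    have hH := sum_posterior_div_mem_Icc P κ hp₀ hp p.1
    have hvmem := fun m => posterior_div_mem_Icc P κ hp₀ hp p.1 m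
    have hi1 : 0 ≤ (Prod.fst ⁻¹' G).indicator (fun _ => (1 : ℝ)) p :=
      Set.indicator_nonneg (fun _ _ => zero_le_one) _
    have hi2 : 0 ≤ A'.indicator (fun _ => (1 : ℝ)) p :=
      Set.indicator_nonneg (fun _ _ => zero_le_one) _
    have hp₀' : 0 < 1 / p₀ := by positivity
    by_cases hpG : p.1 ∈ G
    · have e : (Prod.fst ⁻¹' G).indicator (fun _ => (1 : ℝ)) p = 1 :=
        Set.indicator_of_mem (s := Prod.fst ⁻¹' G) hpG _
      rw [e]
      calc v p.1 (g p.1) - v p.1 (f p.1) ≤ 1 / p₀ * 1 := by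
            linarith [(hvmem (g p.1)).2, (hvmem (f p.1)).1]
        _ ≤ _ := by
            gcongr
            have := mul_nonneg ht.le hi2
            linarith
    · have hw := hpg hpG
      rcases le_or_gt (v p.1 (g p.1)) (v p.1 (f p.1)) with h | h
      · have : 0 ≤ (1 / p₀) * ((Prod.fst ⁻¹' G).indicator (fun _ => (1 : ℝ)) p
          + t * A'.indicator (fun _ => (1 : ℝ)) p) := by positivity
        linarith
      · have hHpos : 0 < ∑ m, _root_.posterior κ p.1 m / classProb P m := by linarith [hH.1]
        have hlt : weightedPosterior P κ p.1 (f p.1) < weightedPosterior P κ p.1 (g p.1) :=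
          div_lt_div_of_pos_right h hHpos
        have hpA : p ∈ A := abs_kthLargest_sub_le hM hlt hw
        have e : A'.indicator (fun _ => (1 : ℝ)) p = 1 :=
          Set.indicator_of_mem (subset_toMeasurable P A hpA) _
        rw [e]
        have h1 := hw (g p.1)
        simp only [weightedPosterior] at h1
        rw [div_le_iff₀ hHpos, add_mul, div_mul_cancel₀ _ hHpos.ne'] at h1
        calc v p.1 (g p.1) - v p.1 (f p.1)
            ≤ t * ∑ m, _root_.posterior κ p.1 m / classProb P m := by linarith
          _ ≤ t * (1 / p₀) := by gcongr; exact hH.2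
          _ = 1 / p₀ * (t * 1) := by ring
          _ ≤ _ := by gcongr; linarith
  have hint : ∫ p, v p.1 (g p.1) ∂P - ∫ p, v p.1 (f p.1) ∂P ≤
      (1 / p₀) * (P.real (Prod.fst ⁻¹' G) + t * P.real A') := by
    rw [← integral_sub (hv hg) (hv hf)]
    have i1 : Integrable ((Prod.fst ⁻¹' G).indicator fun _ => (1 : ℝ)) P :=
      (integrable_const 1).indicator hG'm
    have i2 : Integrable (A'.indicator fun _ => (1 : ℝ)) P := (integrable_const 1).indicator hA'm
    refine (integral_mono_ae ((hv hg).sub (hv hf))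
      ((i1.add (i2.const_mul t)).const_mul (1 / p₀)) hpt).trans (le_of_eq ?_)
    simp only [Pi.add_apply]
    rw [integral_const_mul, integral_add i1 (i2.const_mul t), integral_const_mul,
      integral_indicator_const _ hG'm, integral_indicator_const _ hA'm]
    simp
  rw [amRecall_eq_integral P κ hp₀ hp hg, amRecall_eq_integral P κ hp₀ hp hf,
    ← sub_le_iff_le_add, ← mul_sub]
  have hτ0 : 0 ≤ (1 / p₀) * (P.real (Prod.fst ⁻¹' G) + t * P.real A') := by positivity
  calc _ ≤ (1 / (M : ℝ)) * ((1 / p₀) * (P.real (Prod.fst ⁻¹' G) + t * P.real A')) := by gcongr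
    _ ≤ (1 / p₀) * (P.real (Prod.fst ⁻¹' G) + t * P.real A') :=
        mul_le_of_le_one_left hτ0 ((div_le_one (by linarith)).2 hM')
    _ ≤ (1 / p₀) * (τ + t * (cβ * t ^ β)) := by gcongr
    _ = _ := by ring

end Regret

/-! ### Deviation bounds for deterministic acceptance probabilities -/

section Deviation

lemma ae_fst_mem_unitCube {d M : ℕ} (P : Measure (Feature d × Fin M))
    (hX : P.map Prod.fst = volume.restrict (unitCube d)) :
    ∀ᵐ p ∂P, p.1 ∈ unitCube d := by
  have h : ∀ᵐ x ∂(P.map Prod.fst), x ∈ unitCube d := by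
    rw [hX]; exact ae_restrict_mem measurableSet_unitCube
  exact ae_of_ae_map measurable_fst.aemeasurable h

variable {n d M : ℕ} (P : Measure (Feature d × Fin M)) [IsProbabilityMeasure P]
  (κ : Kernel (Feature d) (Fin M)) [IsMarkovKernel κ]

lemma measure_classCount_deviation_le {ε : ℝ} (hε : 0 ≤ ε) :
    (Measure.pi fun _ : Fin n => P) {D | ∃ m, n * ε ≤ |(classCount D m : ℝ) - n * classProb P m|} ≤
      ENNReal.ofReal (M * (2 * Real.exp (-2 * n * ε ^ 2))) := by
  classical
  have hYm : ∀ m, MeasurableSet {p : Feature d × Fin M | p.2 = m} := fun m =>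
    (measurableSet_singleton m).preimage measurable_snd
  rw [Set.ofPred_exists]
  refine (measure_iUnion_fintype_le _ _).trans ?_
  calc _ ≤ ∑ _m : Fin M, ENNReal.ofReal (2 * Real.exp (-2 * n * ε ^ 2)) := by
        refine Finset.sum_le_sum fun m _ => ?_
        have h := hoeffding_pi P (f := {p : Feature d × Fin M | p.2 = m}.indicator fun _ => (1 : ℝ))
          (measurable_const.indicator (hYm m)) (fun p => ?_) n hε
        · rw [integral_indicator_const _ (hYm m), smul_eq_mul, mul_one] at h
          refine le_trans (le_of_eq ?_) h
          congr 1
          ext D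
          simp [classCount, classProb, Set.indicator_apply]
        · rw [Set.indicator_apply]
          split_ifs <;> simp
    _ = _ := by
      rw [← ENNReal.ofReal_sum_of_nonneg fun _ _ => by positivity]
      simp

lemma le_real_dist_le (hX : P.map Prod.fst = volume.restrict (unitCube d)) {x : Feature d}
    (hx : x ∈ unitCube d) {δ : ℝ} (hδ : δ ∈ Set.Icc (0 : ℝ) 1) :
    δ ^ d ≤ P.real {z | dist z.1 x ≤ √d * δ} := by
  have hm : MeasurableSet {z : Feature d | dist z x ≤ √d * δ} :=
    measurableSet_le (by fun_prop) measurable_const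
  have h1 : P {z | dist z.1 x ≤ √d * δ} =
      volume ({z : Feature d | dist z x ≤ √d * δ} ∩ unitCube d) := by
    rw [← Measure.restrict_apply hm, ← hX, Measure.map_apply measurable_fst hm]
    rfl
  rw [measureReal_def, h1, ← ENNReal.ofReal_le_iff_le_toReal (h1 ▸ measure_ne_top _ _)]
  exact pow_le_volume_closedBall_inter_unitCube hx hδ

lemma measure_expectedPosterior_deviation_le [P.IsCondKernel κ]
    (hX : P.map Prod.fst = volume.restrict (unitCube d)) {a : Fin M → ℝ} {a₀ a₁ t e ε δ : ℝ}
    (ha₀ : 0 < a₀) (ha₀1 : a₀ ≤ 1) (ha : ∀ l, a₀ ≤ a l) (ha' : ∀ l, a l ≤ a₁) (ha₁ : ∀ l, a l ≤ 1)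
    (ht : 0 ≤ t) (he : 0 ≤ e) (hε : 0 < ε) (hδ : δ ∈ Set.Icc (0 : ℝ) 1) {x : Feature d}
    (hx : x ∈ unitCube d) (h : ∀ x' ∈ unitCube d, dist x' x ≤ √d * δ → ∀ m,
      |reweightedPosterior κ a x' m - reweightedPosterior κ a x m| ≤ e) :
    (Measure.pi fun _ : Fin n => P) {D | ∃ m, t + (e + ε) ≤
      |expectedPosterior a D x m - reweightedPosterior κ a x m|} ≤
      ENNReal.ofReal (M * (2 * Real.exp (-t ^ 2 / (2 * (a₁ ^ 2 / a₀))))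
        + Real.exp (-(n * (a₀ * δ ^ d))) / ε) := by
  classical
  set V := a₁ ^ 2 / a₀
  -- Smoothness is available only on the cube, so the null event of a feature outside it is
  -- discarded.
  have hcube : (Measure.pi fun _ : Fin n => P) {D | ¬ ∀ i, (D i).1 ∈ unitCube d} = 0 := by
    rw [← ae_iff, ae_all_iff]
    intro i
    exact (measurePreserving_eval (fun _ : Fin n => P) i).quasiMeasurePreserving.ae
      (ae_fst_mem_unitCube P hX)
  have hsub : {D : DataSet n d M | ∃ m, t + (e + ε) ≤
      |expectedPosterior a D x m - reweightedPosterior κ a x m|} ⊆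
      ((⋃ m, {D | t ≤ |centeredPart κ a D x m|}) ∪
        {D | ε ≤ ∏ i, if dist (D i).1 x ≤ √d * δ then 1 - a₀ else 1}) ∪
        {D | ¬ ∀ i, (D i).1 ∈ unitCube d} := by
    rintro D ⟨m, hm⟩
    by_contra hcon
    simp only [Set.mem_union, Set.mem_iUnion, Set.mem_ofPred_eq, not_or, not_exists, not_le,
      not_not] at hcon
    obtain ⟨⟨h1, h2⟩, h3⟩ := hcon
    have h4 := abs_expectedPosterior_sub_le κ ha₀.le ha ha₁ D x m he
      (fun i hi => h _ (h3 i) hi m)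
    have h5 := h1 m
    linarith
  refine (measure_mono hsub).trans ((measure_union_le _ _).trans ?_)
  rw [hcube, add_zero, ENNReal.ofReal_add (by positivity) (by positivity)]
  refine (measure_union_le _ _).trans (add_le_add ?_ ?_)
  · refine (measure_iUnion_fintype_le _ _).trans ?_
    calc _ ≤ ∑ _m : Fin M, ENNReal.ofReal (2 * Real.exp (-t ^ 2 / (2 * V))) :=
          Finset.sum_le_sum fun m _ => measure_centeredPart_ge_le P κ ha₀ ha ha' ha₁ ht x m
      _ = _ := by
        rw [← ENNReal.ofReal_sum_of_nonneg fun _ _ => by positivity]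
        simp
  · exact measure_prod_ite_ge_le P ha₀.le ha₀1 x (le_real_dist_le P hX hx hδ) hε

/-- Smoothness of the posterior passes to the reweighted one at the cost of the ratio `a₁ / a₀`,
which stays bounded although both are small. -/
lemma abs_reweightedPosterior_sub_le {a : Fin M → ℝ} {a₀ a₁ Δ : ℝ} (ha₀ : 0 < a₀)
    (ha : ∀ l, a₀ ≤ a l) (ha' : ∀ l, a l ≤ a₁) {x x' : Feature d}
    (h : ∀ m, |_root_.posterior κ x' m - _root_.posterior κ x m| ≤ Δ) (m : Fin M) :
    |reweightedPosterior κ a x' m - reweightedPosterior κ a x m| ≤ (M + 1) * (a₁ * Δ) / a₀ := by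
  have ha0 : ∀ l, 0 ≤ a l := fun l => ha₀.le.trans (ha l)
  refine abs_div_sum_sub_div_sum_le (fun l => mul_nonneg (ha0 l) (posterior_nonneg κ x' l))
    (ha₀.trans_le (le_sum_mul_posterior κ ha x')) ha₀ (le_sum_mul_posterior κ ha x)
    (fun l => ?_) m
  rw [← mul_sub, abs_mul, abs_of_nonneg (ha0 l)]
  exact mul_le_mul (ha' l) (h l) (abs_nonneg _) ((ha0 l).trans (ha' l))

/-- Replacing the class proportions by class frequencies changes the weighted posterior
probabilities little. -/
lemma abs_reweightedPosterior_sub_weightedPosterior_le {p₀ ε s : ℝ} (hp₀ : 0 < p₀)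
    (hp : ∀ m, p₀ ≤ classProb P m) (hn : 0 < n) (hM : 0 < M) (hs : 0 < s) {ν : Fin M → ℕ}
    (hν : ∀ m, n * p₀ / 2 ≤ ν m) (hνε : ∀ m, |(ν m : ℝ) - n * classProb P m| ≤ n * ε)
    (x : Feature d) (m : Fin M) :
    |reweightedPosterior κ (fun l => s / (M * ν l)) x m - weightedPosterior P κ x m| ≤
      (M + 1) * (2 * ε / p₀ ^ 2) := by
  have hn' : (0 : ℝ) < n := by exact_mod_cast hn
  have hM' : (0 : ℝ) < M := by exact_mod_cast hM
  have hνpos : ∀ m, (0 : ℝ) < ν m := fun m => lt_of_lt_of_le (by positivity) (hν m)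
  have hπ : ∀ m, 0 < classProb P m := fun m => hp₀.trans_le (hp m)
  -- Reweighting ignores common factors of the weights, so `s / (M * ν l)` may be replaced by `n / ν
  -- l`, which is close to `1 / π_l`.
  have e : reweightedPosterior κ (fun l => s / (M * ν l)) x m =
      (n / ν m * _root_.posterior κ x m) / ∑ j, n / ν j * _root_.posterior κ x j := by
    have h1 : ∀ l, s / (M * ν l) * _root_.posterior κ x l =
        s / (M * n) * (n / ν l * _root_.posterior κ x l) := by
      intro l
      have := (hνpos l).ne'
      field_simp
    simp only [reweightedPosterior, h1, ← Finset.mul_sum]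
    exact mul_div_mul_left _ _ (by positivity)
  rw [e, weightedPosterior]
  have hsum : (0 : ℝ) < ∑ j, n / ν j * _root_.posterior κ x j := by
    have h1 : ∀ l, (1 : ℝ) / (∑ j, (ν j : ℝ)) ≤ 1 / (ν l : ℝ) := fun l =>
      one_div_le_one_div_of_le (hνpos l)
        (Finset.single_le_sum (f := fun j => (ν j : ℝ)) (fun j _ => (hνpos j).le) (Finset.mem_univ l))
    have h2 : (0 : ℝ) < ∑ j, (ν j : ℝ) :=
      (hνpos m).trans_le (Finset.single_le_sum (f := fun j => (ν j : ℝ))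
        (fun j _ => (hνpos j).le) (Finset.mem_univ m))
    refine lt_of_lt_of_le (b := n * (1 / (∑ j, (ν j : ℝ)))) (by positivity)
      (le_sum_mul_posterior κ (fun l => ?_) x)
    rw [div_eq_mul_one_div (n : ℝ) (ν l : ℝ)]
    exact mul_le_mul_of_nonneg_left (h1 l) hn'.le
  -- `v₀ = 1` is allowed because `π_l ≤ 1` gives `∑ η_l / π_l ≥ ∑ η_l = 1`.
  have h := abs_div_sum_sub_div_sum_le (u := fun l => n / ν l * _root_.posterior κ x l)
    (v := fun l => _root_.posterior κ x l / classProb P l) (Δ := 2 * ε / p₀ ^ 2) (v₀ := 1)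
    (fun l => mul_nonneg (div_nonneg hn'.le (hνpos l).le) (posterior_nonneg κ x l)) hsum one_pos
    (sum_posterior_div_mem_Icc P κ hp₀ hp x).1 (fun l => ?_) m
  · simpa using h
  · have h1 : n / ν l * _root_.posterior κ x l - _root_.posterior κ x l / classProb P l =
        _root_.posterior κ x l * ((n * classProb P l - ν l) / (ν l * classProb P l)) := by
      have := (hνpos l).ne'
      have := (hπ l).ne'
      field_simp
    rw [h1, abs_mul, abs_of_nonneg (posterior_nonneg κ x l), abs_div,
      abs_of_pos (mul_pos (hνpos l) (hπ l)), abs_sub_comm]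
    have hε : 0 ≤ n * ε := (abs_nonneg _).trans (hνε l)
    calc _ ≤ 1 * (n * ε / ((n * p₀ / 2) * p₀)) := by
          gcongr
          · exact div_nonneg (abs_nonneg _) (mul_pos (hνpos l) (hπ l)).le
          · exact posterior_le_one κ x l
          · exact hνε l
          · exact hν l
          · exact hp l
      _ = _ := by field_simp

/-- The lower integral of a function that is large off a small set. -/
lemma ofReal_le_lintegral_of_large {Ω : Type*} [MeasurableSpace Ω] (ν : Measure Ω)
    [IsProbabilityMeasure ν] {F : Ω → ℝ≥0∞} {V : Set Ω} {δ₁ δ₂ : ℝ} (hδ₁ : 0 ≤ δ₁) (hδ₂ : 0 ≤ δ₂)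
    (hV : ν V ≤ ENNReal.ofReal δ₁) (hF : ∀ ω ∉ V, ENNReal.ofReal (1 - δ₂) ≤ F ω) :
    ENNReal.ofReal (1 - δ₁ - δ₂) ≤ ∫⁻ ω, F ω ∂ν := by
  rcases le_or_gt 1 δ₂ with h2 | h2
  · rw [ENNReal.ofReal_of_nonpos (by linarith)]; exact zero_le
  -- Neither `V` nor `F` is assumed measurable: a measurable hull replaces `V`, and `F` is only
  -- bounded below by a constant.
  set V' := toMeasurable ν V
  have hV'm : MeasurableSet V' := measurableSet_toMeasurable _ _
  have h1 : 1 - δ₁ ≤ ν.real V'ᶜ := by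
    rw [probReal_compl_eq_one_sub hV'm, measureReal_def, measure_toMeasurable]
    have := ENNReal.toReal_mono (by simp) hV
    rw [ENNReal.toReal_ofReal hδ₁] at this
    linarith
  calc ENNReal.ofReal (1 - δ₁ - δ₂) ≤ ENNReal.ofReal ((1 - δ₂) * ν.real V'ᶜ) := by
        apply ENNReal.ofReal_le_ofReal
        nlinarith [mul_le_mul_of_nonneg_left h1 (by linarith : 0 ≤ 1 - δ₂), mul_nonneg hδ₁ hδ₂]
    _ = ENNReal.ofReal (1 - δ₂) * ν V'ᶜ := by
        rw [ENNReal.ofReal_mul (by linarith), ofReal_measureReal]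
    _ = ∫⁻ _ω in V'ᶜ, ENNReal.ofReal (1 - δ₂) ∂ν := by simp
    _ ≤ ∫⁻ ω in V'ᶜ, F ω ∂ν := by
        refine setLIntegral_mono' hV'm.compl fun ω hω => hF ω fun h => hω ?_
        exact subset_toMeasurable ν V h
    _ ≤ _ := setLIntegral_le_lintegral _ _

end Deviation

/-! ### Error of the expected vote at a point, for frozen class counts -/

section RegretBound

lemma measurable_weightedPosterior {d M : ℕ} (P : Measure (Feature d × Fin M))
    (κ : Kernel (Feature d) (Fin M)) (m : Fin M) :
    Measurable fun x => weightedPosterior P κ x m := by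
  have := measurable_posterior κ
  unfold weightedPosterior
  fun_prop

variable {d M : ℕ} (P : Measure (Feature d × Fin M)) [IsProbabilityMeasure P]
  (κ : Kernel (Feature d) (Fin M)) [IsMarkovKernel κ]

/-- The constant in the uniform rate of the expected posterior estimate. -/
def deviationConst (d M : ℕ) (p₀ α cL K A : ℝ) : ℝ :=
  √(8 * K * A) / p₀ + ((M + 1) * (2 / p₀ * cL * (√d ^ α * (2 * K * M) ^ (α / d) * A)) + 1)
    + (M + 1) * (4 * √A / p₀ ^ 2)

/-- The counts `ν` are frozen, so the acceptance probabilities do not depend on the data. `h1`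
controls the martingale part, `h2` the bias, and `h3` keeps the localisation radius `δ` at most one.
-/
lemma measure_weightedPosterior_deviation_le [P.IsCondKernel κ] (hd : 1 ≤ d) (hM : 2 ≤ M)
    (hX : P.map Prod.fst = volume.restrict (unitCube d)) {n : ℕ} (hn : 3 ≤ n)
    {p₀ α cL K A φ s : ℝ} (hp₀ : 0 < p₀) (hp : ∀ m, p₀ ≤ classProb P m) (hα : 0 ≤ α) (hcL : 0 < cL)
    (hholder : HolderPosterior κ α cL) (hK : 1 ≤ K) (hA : 0 < A) (hφ : (n : ℝ) ^ (-(1 / 2) : ℝ) ≤ φ)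
    {ν : Fin M → ℕ} (hν : ∀ m, n * p₀ / 2 ≤ ν m) (hνn : ∀ m, ν m ≤ n)
    (hνε : ∀ m, |(ν m : ℝ) - n * classProb P m| ≤ n * (2 * √(Real.log n / n)))
    (hsν : ∀ m, s ≤ M * ν m) (h1 : s * Real.log n / n ≤ A * φ ^ 2)
    (h2 : (Real.log n / s) ^ (α / d) ≤ A * φ) (h3 : 2 * K * M * Real.log n ≤ s)
    {x : Feature d} (hx : x ∈ unitCube d) :
    (Measure.pi fun _ : Fin n => P) {D | ∃ m, deviationConst d M p₀ α cL K A * φ ≤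
      |expectedPosterior (fun l => s / (M * ν l)) D x m - weightedPosterior P κ x m|} ≤
      ENNReal.ofReal ((2 * M + 1) * (n : ℝ) ^ (-K)) := by
  have hn' : (0 : ℝ) < n := by positivity
  have hM' : (2 : ℝ) ≤ M := by exact_mod_cast hM
  have hd' : (0 : ℝ) < d := by exact_mod_cast hd
  set L := Real.log n with hLdef
  have hL1 : 1 ≤ L := by
    rw [hLdef, Real.le_log_iff_exp_le hn']
    have : (3 : ℝ) ≤ n := by exact_mod_cast hn
    linarith [Real.exp_one_lt_d9]
  have hφ0 : 0 < φ := lt_of_lt_of_le (by positivity) hφ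
  have hKML : 4 ≤ 2 * K * M * L := by
    have : 2 ≤ K * M := by nlinarith
    nlinarith
  have hs1 : 1 ≤ s := by linarith
  have hs0 : 0 < s := by linarith
  have hνpos : ∀ m, (0 : ℝ) < ν m := fun m => lt_of_lt_of_le (by positivity) (hν m)
  have hnK : Real.exp (-(K * L)) = (n : ℝ) ^ (-K) := by
    rw [Real.rpow_def_of_pos hn']; congr 1; ring
  -- Bounds for `s / (M * ν l)` from `n * p₀ / 2 ≤ ν l ≤ n`.
  set a₀ := s / (M * n)
  set a₁ := 2 * s / (M * n * p₀)
  -- Here `a₁ ^ 2 / a₀ = 4 * s / (M * n * p₀ ^ 2)`, so this `t` and `h1` make the sub-Gaussian tail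
  -- at most `n ^ (-K)`.
  set t := √(8 * K * A) / p₀ * φ
  -- Chosen so that `n * a₀ * δ ^ d = 2 * K * L`: the missing mass has mean at most `n ^ (-2K)`, and
  -- Markov at level `ε = n ^ (-K)` leaves `n ^ (-K)`.
  set δ := (2 * K * M * L / s) ^ (1 / (d : ℝ))
  set ε := (n : ℝ) ^ (-K)
  set e := (M + 1) * (2 / p₀ * cL * (√d ^ α * (2 * K * M) ^ (α / d) * A)) * φ
  have ha₀ : 0 < a₀ := by positivity
  have hδ0 : 0 ≤ δ := by positivity
  have hδ1 : δ ≤ 1 := Real.rpow_le_one (by positivity) ((div_le_one hs0).2 h3) (by positivity)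
  have hε : ε ≤ φ := le_trans
    (Real.rpow_le_rpow_of_exponent_le (by exact_mod_cast (by omega : 1 ≤ n)) (by linarith)) hφ
  have ha : ∀ l, a₀ ≤ s / (M * ν l) := by
    intro l
    have := hνpos l
    have : (ν l : ℝ) ≤ n := by exact_mod_cast hνn l
    simp only [a₀]
    gcongr
  have ha' : ∀ l, s / (M * ν l) ≤ a₁ := by
    intro l
    have h : a₁ = s / (M * (n * p₀ / 2)) := by simp only [a₁]; field_simp
    rw [h]
    have := hν l
    gcongr
  have ha1 : ∀ l, s / (M * ν l) ≤ 1 := fun l =>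
    (div_le_one (mul_pos (by linarith) (hνpos l))).2 (hsν l)
  have ha₀1 : a₀ ≤ 1 := (ha ⟨0, by omega⟩).trans (ha1 _)
  have hδα : (√d * δ) ^ α ≤ √d ^ α * (2 * K * M) ^ (α / d) * A * φ := by
    have e1 : (√d * δ) ^ α = √d ^ α * (2 * K * M) ^ (α / d) * (L / s) ^ (α / d) := by
      have e2 : δ ^ α = (2 * K * M) ^ (α / d) * (L / s) ^ (α / d) := by
        simp only [δ]
        rw [← Real.rpow_mul (by positivity), mul_div_assoc, Real.mul_rpow (by positivity)
          (by positivity), one_div_mul_eq_div]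
      rw [Real.mul_rpow (Real.sqrt_nonneg _) hδ0, e2, ← mul_assoc]
    rw [e1, mul_assoc _ A φ]
    exact mul_le_mul_of_nonneg_left h2 (by positivity)
  have hbias : ∀ x' ∈ unitCube d, dist x' x ≤ √d * δ → ∀ m,
      |reweightedPosterior κ (fun l => s / (M * ν l)) x' m
        - reweightedPosterior κ (fun l => s / (M * ν l)) x m| ≤ e := by
    intro x' hx' hdist m
    refine (abs_reweightedPosterior_sub_le κ (Δ := cL * (√d * δ) ^ α) ha₀ ha ha' (fun l => ?_)
      m).trans ?_
    · refine (hholder x hx x' hx' l).trans ?_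
      rw [← dist_eq_norm]
      gcongr
    · have h : (M + 1) * (a₁ * (cL * (√d * δ) ^ α)) / a₀
          = (M + 1) * (2 / p₀ * cL * (√d * δ) ^ α) := by
        simp only [a₀, a₁]; field_simp
      rw [h]
      calc _ ≤ (M + 1) * (2 / p₀ * cL * (√d ^ α * (2 * K * M) ^ (α / d) * A * φ)) := by gcongr
        _ = e := by simp only [e]; ring
  have key := measure_expectedPosterior_deviation_le (n := n) P κ hX (t := t) ha₀ ha₀1 ha ha' ha1
    (by positivity) (by positivity : 0 ≤ e) (by positivity : 0 < ε) ⟨hδ0, hδ1⟩ hx hbias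
  have hcount : ∀ m, |reweightedPosterior κ (fun l => s / (M * ν l)) x m
      - weightedPosterior P κ x m| ≤ (M + 1) * (4 * √A / p₀ ^ 2) * φ := by
    intro m
    refine (abs_reweightedPosterior_sub_weightedPosterior_le P κ hp₀ hp (by omega) (by omega) hs0
      hν hνε x m).trans ?_
    -- Since `s ≥ 1`, the class-frequency error is dominated by the martingale error.
    have h : √(L / n) ≤ √A * φ := by
      rw [← Real.sqrt_sq hφ0.le, ← Real.sqrt_mul hA.le]
      apply Real.sqrt_le_sqrt
      refine le_trans ?_ h1
      gcongr
      nlinarith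
    calc _ ≤ (M + 1) * (2 * (2 * (√A * φ)) / p₀ ^ 2) := by gcongr
      _ = _ := by ring
  refine (measure_mono ?_).trans (key.trans (ENNReal.ofReal_le_ofReal ?_))
  · rintro D ⟨m, hm⟩
    refine ⟨m, ?_⟩
    have h4 := abs_sub_le (expectedPosterior (fun l => s / (M * ν l)) D x m)
      (reweightedPosterior κ (fun l => s / (M * ν l)) x m) (weightedPosterior P κ x m)
    have h5 := hcount m
    have h6 : deviationConst d M p₀ α cL K A * φ
        = t + (e + φ) + (M + 1) * (4 * √A / p₀ ^ 2) * φ := by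
      simp only [deviationConst, t, e]; ring
    linarith
  · have b1 : Real.exp (-t ^ 2 / (2 * (a₁ ^ 2 / a₀))) ≤ (n : ℝ) ^ (-K) := by
      change _ ≤ ε
      rw [← hnK]
      apply Real.exp_le_exp.2
      have e1 : -t ^ 2 / (2 * (a₁ ^ 2 / a₀)) = -(K * (M * (A * φ ^ 2 * n / s))) := by
        simp only [t, a₀, a₁, mul_pow, div_pow, Real.sq_sqrt (by positivity : 0 ≤ 8 * K * A)]
        field_simp
        ring
      rw [e1, neg_le_neg_iff]
      have e2 : L ≤ A * φ ^ 2 * n / s := by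
        rw [le_div_iff₀ hs0]
        rw [div_le_iff₀ hn'] at h1
        linarith
      have : L ≤ M * (A * φ ^ 2 * n / s) := by nlinarith
      gcongr
    have b2 : Real.exp (-(n * (a₀ * δ ^ d))) / ε = (n : ℝ) ^ (-K) := by
      have e1 : δ ^ d = 2 * K * M * L / s := by
        rw [← Real.rpow_natCast, ← Real.rpow_mul (by positivity), one_div,
          inv_mul_cancel₀ hd'.ne', Real.rpow_one]
      have e2 : -(n * (a₀ * δ ^ d)) = -(K * L) + -(K * L) := by
        rw [e1]; simp only [a₀]; field_simp; ring
      rw [e2, Real.exp_add, hnK]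
      exact mul_div_cancel_right₀ _ (by positivity)
    rw [b2]
    linarith [mul_le_mul_of_nonneg_left b1 (by positivity : (0 : ℝ) ≤ M * 2)]

lemma sum_classCount {n : ℕ} (D : DataSet n d M) : ∑ m, classCount D m = n := by
  classical
  have := Finset.card_eq_sum_card_fiberwise (s := (Finset.univ : Finset (Fin n)))
    (t := (Finset.univ : Finset (Fin M))) (f := fun i => (D i).2) (fun _ _ => Finset.mem_univ _)
  rw [Finset.card_univ, Fintype.card_fin] at this
  exact this.symm

end RegretBound

/-! ### Union bound over class counts and the general regret bound -/

section Core

variable {d M : ℕ} (P : Measure (Feature d × Fin M)) [IsProbabilityMeasure P]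
  (κ : Kernel (Feature d) (Fin M)) [IsMarkovKernel κ]

/-- As `φ ≥ n ^ (-1/2)`, dividing by `φ ^ (β + 1)` in Markov's inequality costs at most `n ^ ((β +
1) / 2)`, and the union over count vectors at most `(2n) ^ M`. The exponent pays for both and leaves
`n ^ (-3)`, one power of which absorbs the constants. -/
lemma union_bound_le {n M : ℕ} {β φ : ℝ} (hn : 0 < n) (hβ : 0 < β)
    (hnM : (2 * M + 1) * 2 ^ M ≤ n) (hφ : (n : ℝ) ^ (-(1 / 2) : ℝ) ≤ φ) :
    ((n : ℝ) + 1) ^ M * ((2 * M + 1) * (n : ℝ) ^ (-(M + (β + 1) / 2 + 3)) / φ ^ (β + 1))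
      ≤ 1 / (n : ℝ) ^ 2 := by
  have hn' : (0 : ℝ) < n := by exact_mod_cast hn
  have hn1 : (1 : ℝ) ≤ n := by exact_mod_cast hn
  have hφ0 : 0 < φ := lt_of_lt_of_le (by positivity) hφ
  have hnM' : ((2 : ℝ) * M + 1) * 2 ^ M ≤ n := by exact_mod_cast hnM
  have h1 : (n : ℝ) ^ (-((β + 1) / 2)) ≤ φ ^ (β + 1) := by
    have := Real.rpow_le_rpow (by positivity) hφ (by linarith : 0 ≤ β + 1)
    rw [← Real.rpow_mul hn'.le] at this
    convert this using 2
    ring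
  have h2 : (n : ℝ) ^ (-(M + (β + 1) / 2 + 3)) / φ ^ (β + 1) ≤ 1 / (n : ℝ) ^ (M + 3) := by
    rw [div_le_iff₀ (by positivity)]
    calc (n : ℝ) ^ (-(M + (β + 1) / 2 + 3))
        = 1 / (n : ℝ) ^ (M + 3) * (n : ℝ) ^ (-((β + 1) / 2)) := by
          rw [← Real.rpow_natCast, one_div, ← Real.rpow_neg hn'.le, ← Real.rpow_add hn']
          congr 1
          push_cast
          ring
      _ ≤ _ := by gcongr
  calc _ = (n + 1 : ℝ) ^ M * (2 * M + 1) *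
        ((n : ℝ) ^ (-(M + (β + 1) / 2 + 3)) / φ ^ (β + 1)) := by ring
    _ ≤ (2 * n : ℝ) ^ M * (2 * M + 1) * (1 / (n : ℝ) ^ (M + 3)) := by
        gcongr
        linarith
    _ = ((2 * M + 1) * 2 ^ M / n) * (1 / (n : ℝ) ^ 2) := by
        rw [mul_pow]; field_simp; ring
    _ ≤ 1 * (1 / (n : ℝ) ^ 2) := by
        gcongr
        exact (div_le_one hn').2 hnM'
    _ = _ := one_mul _

/-- Regret bound at the rate `φ ^ (β + 1)` when the standard deviations of the subsampling and of
the bagging, and the bias, are of the order `φ`. -/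
theorem exists_regret_bound [P.IsCondKernel κ] (hd : 1 ≤ d) (hM : 2 ≤ M)
    (hX : P.map Prod.fst = volume.restrict (unitCube d))
    {p₀ α β cL cβ : ℝ} (hp₀ : 0 < p₀) (hp : ∀ m, p₀ ≤ classProb P m) (hα : 0 ≤ α) (hβ : 0 < β)
    (hcL : 0 < cL) (hcβ : 0 < cβ) (hholder : HolderPosterior κ α cL)
    (hmargin : MarginCondition P κ hM β cβ) :
    ∃ Λ : ℝ, 0 < Λ ∧ ∀ A : ℝ, 0 < A → ∃ N : ℕ, ∃ c : ℝ, 0 < c ∧ ∀ n : ℕ, N ≤ n → ∀ φ : ℝ,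
      (n : ℝ) ^ (-(1 / 2) : ℝ) ≤ φ → ∀ (σ : ℕ → ℝ) (s : DataSet n d M → ℝ) (B : DataSet n d M → ℕ),
      (∀ D, s D = σ (minorityCount D)) →
      (∀ k : ℕ, n * p₀ / 2 ≤ k → M * k ≤ n → σ k ≤ M * k ∧ σ k * Real.log n / n ≤ A * φ ^ 2 ∧
        (Real.log n / σ k) ^ (α / d) ≤ A * φ ∧ Λ * Real.log n ≤ σ k) →
      (∀ D : DataSet n d M, n * p₀ / 2 ≤ minorityCount D → M * minorityCount D ≤ n →
        Real.log n ≤ A * φ ^ 2 * B D) →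
      ENNReal.ofReal (1 - 5 / (n : ℝ) ^ 2) ≤ regretBoundProb P n 1 s B (c * φ ^ (β + 1)) := by
  have hM' : (2 : ℝ) ≤ M := by exact_mod_cast hM
  set K : ℝ := M + (β + 1) / 2 + 3 with hKdef
  have hK : 1 ≤ K := by rw [hKdef]; linarith
  -- `Λ` depends only on `M` and `β`, and so can be fixed before `A`.
  refine ⟨2 * K * M, by positivity, fun A hA => ?_⟩
  set C₁ := deviationConst d M p₀ α cL K A
  set C₂ := √(K * A)
  have hC₁ : 0 < C₁ := by simp only [C₁, deviationConst]; positivity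
  have hC₂ : 0 < C₂ := Real.sqrt_pos.2 (by positivity)
  set C := C₁ + C₂ with hC
  have hlim : Filter.Tendsto (fun n : ℕ => Real.log n / n) Filter.atTop (nhds 0) := by
    have := (Real.tendsto_pow_log_div_mul_add_atTop 1 0 1 one_ne_zero).comp
      tendsto_natCast_atTop_atTop
    simpa [Function.comp_def] using this
  obtain ⟨N₁, hN₁⟩ := Filter.eventually_atTop.1
    (hlim.eventually_lt_const (by positivity : 0 < (p₀ / 4) ^ 2))
  -- In the constant, `2` counts the two exceptional sets of `x`, each of mass below `φ ^ (β + 1)`;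
  -- the other term comes from the margin condition at level `2 * C * φ`.
  refine ⟨max N₁ (max 3 ((2 * M + 1) * 2 ^ M)), (2 + cβ * (2 * C) ^ (β + 1)) / p₀, by positivity,
    fun n hn φ hφ σ s B hsσ hσ hB => ?_⟩
  have hn3 : 3 ≤ n := by omega
  have hnM : (2 * M + 1) * 2 ^ M ≤ n := by omega
  have hn' : (0 : ℝ) < n := by positivity
  have hn1 : (1 : ℝ) ≤ n := by exact_mod_cast (by omega : 1 ≤ n)
  have hφ0 : 0 < φ := lt_of_lt_of_le (by positivity) hφ
  set L := Real.log n with hLdef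
  have hL : 0 < L := Real.log_pos (by exact_mod_cast (by omega : 1 < n))
  set ε₁ := 2 * √(L / n) with hε₁
  have hε₁p : ε₁ ≤ p₀ / 2 := by
    have h := hN₁ n (by omega)
    have := Real.sqrt_le_sqrt h.le
    rw [Real.sqrt_sq (by positivity)] at this
    rw [hε₁]; linarith
  set τ := φ ^ (β + 1) with hτ
  have hτ0 : 0 < τ := by positivity
  have hub := union_bound_le (by omega) hβ hnM hφ
  rw [← hKdef, ← hτ] at hub
  set μ : Measure (Feature d) := P.map Prod.fst with hμ
  have : IsProbabilityMeasure μ := Measure.isProbabilityMeasure_map measurable_fst.aemeasurable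
  have hμcube : ∀ᵐ x ∂μ, x ∈ unitCube d := by
    rw [hX]; exact ae_restrict_mem measurableSet_unitCube
  set Q := Measure.pi fun _ : Fin n => P
  set good : (Fin M → ℕ) → Prop := fun ν =>
    (∀ m, |(ν m : ℝ) - n * classProb P m| ≤ n * ε₁) ∧ ∑ m, ν m = n
  have hgoodν : ∀ ν, good ν → ∀ m, n * p₀ / 2 ≤ ν m := by
    intro ν hν m
    have h1 := (abs_le.1 (hν.1 m)).1
    have h2 := mul_le_mul_of_nonneg_left (hp m) hn'.le
    have h3 := mul_le_mul_of_nonneg_left hε₁p hn'.le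
    linarith
  have hinf : ∀ ν, good ν → n * p₀ / 2 ≤ ((⨅ m, ν m : ℕ) : ℝ) ∧ M * (⨅ m, ν m) ≤ n := by
    intro ν hν
    have : Nonempty (Fin M) := ⟨⟨0, by omega⟩⟩
    constructor
    · obtain ⟨m, hm⟩ := exists_eq_ciInf_of_finite (f := ν)
      rw [← hm]; exact hgoodν ν hν m
    · calc M * (⨅ m, ν m) = ∑ _m : Fin M, ⨅ m, ν m := by simp
        _ ≤ ∑ m, ν m := Finset.sum_le_sum fun m _ => ciInf_le (OrderBot.bddBelow _) m
        _ = n := hν.2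
  -- The acceptance probabilities the algorithm would use if the class counts were `ν`.
  set acc : (Fin M → ℕ) → Fin M → ℝ := fun ν l => σ (⨅ m, ν m) / (M * ν l)
  have hacc : ∀ ν, good ν → ∀ l, acc ν l ∈ Set.Icc (0 : ℝ) 1 := by
    intro ν hν l
    obtain ⟨h1, h2⟩ := hinf ν hν
    obtain ⟨h3, _, _, h4⟩ := hσ _ h1 (by exact_mod_cast h2)
    have h5 : ((⨅ m, ν m : ℕ) : ℝ) ≤ ν l := by exact_mod_cast ciInf_le (OrderBot.bddBelow _) l
    have h6 : 0 ≤ σ (⨅ m, ν m) := le_trans (by positivity) h4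
    refine ⟨by positivity, div_le_one_of_le₀ (h3.trans ?_) (by positivity)⟩
    gcongr
  set bad : (Fin M → ℕ) → DataSet n d M → Set (Feature d) := fun ν D =>
    {x | ∃ m, C₁ * φ ≤ |expectedPosterior (acc ν) D x m - weightedPosterior P κ x m|}
  have hbadm : ∀ ν, MeasurableSet {q : DataSet n d M × Feature d | q.2 ∈ bad ν q.1} := by
    intro ν
    simp only [bad, Set.mem_ofPred_eq]
    rw [Set.ofPred_exists]
    refine MeasurableSet.iUnion fun m => measurableSet_le measurable_const ?_
    exact (continuous_abs.measurable).comp ((measurable_expectedPosterior _ m).sub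
      ((measurable_weightedPosterior P κ m).comp measurable_snd))
  have hbad : ∀ ν, good ν → Q {D | ENNReal.ofReal τ ≤ μ (bad ν D)} ≤
      ENNReal.ofReal ((2 * M + 1) * (n : ℝ) ^ (-K) / τ) := by
    intro ν hν
    refine measure_section_gt_le Q μ (hbadm ν) hτ0 ?_
    filter_upwards [hμcube] with x hx
    obtain ⟨h1, h2⟩ := hinf ν hν
    obtain ⟨h3, h4, h5, h6⟩ := hσ _ h1 (by exact_mod_cast h2)
    refine measure_weightedPosterior_deviation_le P κ hd hM hX hn3 hp₀ hp hα hcL hholder hK hA hφ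
      (hgoodν ν hν) (fun m => ?_) hν.1 (fun m => h3.trans ?_) h4 h5 h6 hx
    · rw [← hν.2]
      exact Finset.single_le_sum (fun _ _ => Nat.zero_le _) (Finset.mem_univ m)
    · have : ((⨅ m, ν m : ℕ) : ℝ) ≤ ν m := by exact_mod_cast ciInf_le (OrderBot.bddBelow _) m
      gcongr
  set V₁ : Set (DataSet n d M) := {D | ∃ m, n * ε₁ ≤ |(classCount D m : ℝ) - n * classProb P m|}
  -- The union runs over all count vectors, so off `V₂` the estimate also holds at the random counts
  -- of the data.
  set V₂ : Set (DataSet n d M) := ⋃ ν : Fin M → Fin (n + 1),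
    {D | good (fun m => ν m) ∧ ENNReal.ofReal τ ≤ μ (bad (fun m => ν m) D)}
  have hV₁ : Q V₁ ≤ ENNReal.ofReal (1 / (n : ℝ) ^ 2) := by
    refine (measure_classCount_deviation_le P (by positivity)).trans (ENNReal.ofReal_le_ofReal ?_)
    -- The factor `2` in `ε₁` gives the exponent `2 * 4 = 8`, ample to absorb `2 * M ≤ n`.
    have e1 : Real.exp (-2 * n * ε₁ ^ 2) = 1 / (n : ℝ) ^ 8 := by
      have : -2 * n * ε₁ ^ 2 = -(((8 : ℕ) : ℝ) * L) := by
        rw [hε₁, mul_pow, Real.sq_sqrt (by positivity)]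
        field_simp
        norm_num
      rw [this, Real.exp_neg, Real.exp_nat_mul, Real.exp_log hn', one_div]
    rw [e1]
    have h2M : (2 : ℝ) * M ≤ n := by
      have : 2 * M ≤ n := le_trans (by nlinarith [Nat.one_le_two_pow (n := M)]) hnM
      exact_mod_cast this
    calc M * (2 * (1 / (n : ℝ) ^ 8)) = 2 * M * (1 / (n : ℝ) ^ 8) := by ring
      _ ≤ n ^ 6 * (1 / (n : ℝ) ^ 8) := by
          gcongr
          exact h2M.trans (le_self_pow₀ hn1 (by norm_num))
      _ = _ := by field_simp
  have hV₂ : Q V₂ ≤ ENNReal.ofReal (1 / (n : ℝ) ^ 2) := by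
    refine (measure_iUnion_fintype_le _ _).trans ?_
    calc _ ≤ ∑ _ν : Fin M → Fin (n + 1), ENNReal.ofReal ((2 * M + 1) * (n : ℝ) ^ (-K) / τ) := by
          refine Finset.sum_le_sum fun ν _ => ?_
          by_cases hν : good (fun m => ν m)
          · exact (measure_mono fun D hD => hD.2).trans (hbad _ hν)
          · have : {D | good (fun m => ν m) ∧ ENNReal.ofReal τ ≤ μ (bad (fun m => ν m) D)} = ∅ := by
              ext D; simp [hν]
            rw [this, measure_empty]
            exact zero_le
      _ ≤ _ := by
          rw [← ENNReal.ofReal_sum_of_nonneg fun _ _ => by positivity]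
          apply ENNReal.ofReal_le_ofReal
          rw [Finset.sum_const, Finset.card_univ, Fintype.card_fun, Fintype.card_fin,
            Fintype.card_fin, nsmul_eq_mul]
          push_cast
          exact hub
  have hV : Q (V₁ ∪ V₂) ≤ ENNReal.ofReal (2 / (n : ℝ) ^ 2) := by
    refine (measure_union_le _ _).trans ((add_le_add hV₁ hV₂).trans (le_of_eq ?_))
    rw [← ENNReal.ofReal_add (by positivity) (by positivity)]
    congr 1; ring
  refine le_trans (ENNReal.ofReal_le_ofReal ?_)
    (ofReal_le_lintegral_of_large Q (δ₁ := 2 / (n : ℝ) ^ 2) (δ₂ := 1 / (n : ℝ) ^ 2)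
      (by positivity) (by positivity) hV fun D hD => ?_)
  -- The failure probabilities sum to `3 / n ^ 2`: two for the data and one for the acceptance
  -- variables.
  · have : (0 : ℝ) ≤ 1 / (n : ℝ) ^ 2 := by positivity
    have e5 : 5 / (n : ℝ) ^ 2 = 5 * (1 / (n : ℝ) ^ 2) := by ring
    have e2 : 2 / (n : ℝ) ^ 2 = 2 * (1 / (n : ℝ) ^ 2) := by ring
    linarith
  rw [Set.mem_union, not_or] at hD
  obtain ⟨hD₁, hD₂⟩ := hD
  have hgood : good (classCount D) := by
    refine ⟨fun m => ?_, sum_classCount D⟩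
    by_contra h
    exact hD₁ ⟨m, (not_le.1 h).le⟩
  have hle : ∀ m, classCount D m ≤ n := fun m =>
    (Finset.single_le_sum (fun _ _ => Nat.zero_le _) (Finset.mem_univ m)).trans (sum_classCount D).le
  have hbadD : μ (bad (classCount D) D) < ENNReal.ofReal τ := by
    by_contra h
    exact hD₂ (Set.mem_iUnion.2 ⟨fun m => ⟨classCount D m, Nat.lt_succ_of_le (hle m)⟩,
      hgood, not_lt.1 h⟩)
  have haccD : acceptProb D (s D) = acc (classCount D) := by
    ext l; rw [acceptProb, hsσ]; rfl
  obtain ⟨hk1, hk2⟩ := hinf _ hgood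
  have hBD := hB D hk1 (by exact_mod_cast hk2)
  have hBpos : 0 < B D := by
    by_contra h
    rw [Nat.eq_zero_of_not_pos h] at hBD
    simp only [Nat.cast_zero, mul_zero] at hBD
    linarith
  set badZ : (Fin (B D) → Fin n → Bool) → Set (Feature d) := fun Z => {x | ∃ m, C₂ * φ ≤
      |baggedPosterior 1 D Z x m - expectedPosterior (acceptProb D (s D)) D x m|}
  have hbag := baggingLaw_deviation_le D (s := s D) (by rw [haccD]; exact hacc _ hgood) hBpos μ
    (t := C₂ * φ) (by positivity) hτ0
  have hbag' : baggingLaw D (s D) (B D) {Z | ENNReal.ofReal τ ≤ μ (badZ Z)} ≤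
      ENNReal.ofReal (1 / (n : ℝ) ^ 2) := by
    refine hbag.trans (ENNReal.ofReal_le_ofReal (le_trans ?_ hub))
    have e1 : Real.exp (-2 * B D * (C₂ * φ) ^ 2) ≤ (n : ℝ) ^ (-K) := by
      rw [Real.rpow_def_of_pos hn']
      apply Real.exp_le_exp.2
      rw [mul_pow, Real.sq_sqrt (by positivity)]
      have h := mul_le_mul_of_nonneg_left hBD (by linarith : 0 ≤ K)
      have : 0 ≤ K * L := by positivity
      have e : -2 * B D * (K * A * φ ^ 2) = -2 * (K * (A * φ ^ 2 * B D)) := by ring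
      rw [e]; linarith
    have h1 : 1 ≤ ((n : ℝ) + 1) ^ M := one_le_pow₀ (by linarith)
    calc M * (2 * Real.exp (-2 * B D * (C₂ * φ) ^ 2)) / τ
        ≤ M * (2 * (n : ℝ) ^ (-K)) / τ := by gcongr
      _ = 1 * (2 * M * (n : ℝ) ^ (-K) / τ) := by ring
      _ ≤ ((n : ℝ) + 1) ^ M * ((2 * M + 1) * (n : ℝ) ^ (-K) / τ) := by
          gcongr
          linarith
  set S : Set (Fin (B D) → Fin n → Bool) := {Z | ∀ f, IsUnderBaggingClassifier 1 D Z f →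
    amRegret P f ≤ (2 + cβ * (2 * C) ^ (β + 1)) / p₀ * φ ^ (β + 1)}
  have hsub : Sᶜ ⊆ {Z | ENNReal.ofReal τ ≤ μ (badZ Z)} := by
    intro Z hZ
    by_contra hZ'
    refine hZ fun f hf => ?_
    rw [Set.mem_ofPred_eq, not_le] at hZ'
    set G := bad (classCount D) D ∪ badZ Z
    have hbm : MeasurableSet (bad (classCount D) D) :=
      (hbadm (classCount D)).preimage (f := fun x => (D, x)) (measurable_const.prodMk measurable_id)
    have hzm : MeasurableSet (badZ Z) := by
      simp only [badZ]
      rw [Set.ofPred_exists]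
      refine MeasurableSet.iUnion fun m => measurableSet_le measurable_const ?_
      exact (continuous_abs.measurable).comp
        (((measurable_baggedPosterior D m).comp (measurable_const.prodMk measurable_id)).sub
        ((measurable_expectedPosterior _ m).comp (measurable_const.prodMk measurable_id)))
    have hGτ : μ.real G ≤ 2 * τ := by
      refine (measureReal_union_le _ _).trans ?_
      have h1 := ENNReal.toReal_mono (by simp) hbadD.le
      have h2 := ENNReal.toReal_mono (by simp) hZ'.le
      rw [ENNReal.toReal_ofReal hτ0.le] at h1 h2
      rw [measureReal_def, measureReal_def]
      linarith
    -- The estimate has error at most `C * φ` off `G`, and comparing `f x` with another label uses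
    -- it at both: hence `2 * C * φ`.
    have hreg := amRegret_le P κ hM hp₀ hp hmargin (t := 2 * C * φ) (by positivity) hf.1
      (hbm.union hzm) hGτ (Filter.Eventually.of_forall fun p hpG m => ?_)
    · refine hreg.trans (le_of_eq ?_)
      have e1 : 2 * C * φ * (cβ * (2 * C * φ) ^ β) = cβ * (2 * C) ^ (β + 1) * τ := by
        have h1 : (2 * C * φ) ^ (β + 1) = (2 * C * φ) ^ β * (2 * C * φ) :=
          Real.rpow_add_one (by positivity) β
        rw [mul_assoc cβ, hτ, ← Real.mul_rpow (by positivity) hφ0.le, h1]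
        ring
      rw [e1]; ring
    · simp only [Set.mem_union, not_or, bad, badZ, Set.mem_ofPred_eq, not_exists, not_le,
        haccD] at hpG
      have b1 := fun l => abs_lt.1 (hpG.1 l)
      have b2 := fun l => abs_lt.1 (hpG.2 l)
      have b3 := hf.2 p.1 m
      have e : 2 * C * φ = 2 * (C₁ * φ) + 2 * (C₂ * φ) := by rw [hC]; ring
      linarith [b1 m, b2 m, b1 (f p.1), b2 (f p.1), (b1 m).1, (b2 m).1, (b1 (f p.1)).2,
        (b2 (f p.1)).2]
  have hSc : (baggingLaw D (s D) (B D)) Sᶜ ≤ ENNReal.ofReal (1 / (n : ℝ) ^ 2) :=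
    (measure_mono hsub).trans hbag'
  change ENNReal.ofReal (1 - 1 / (n : ℝ) ^ 2) ≤ baggingLaw D (s D) (B D) S
  rw [ENNReal.ofReal_sub _ (by positivity), ENNReal.ofReal_one]
  rw [tsub_le_iff_right]
  calc (1 : ℝ≥0∞) = baggingLaw D (s D) (B D) (S ∪ Sᶜ) := by simp
    _ ≤ _ := measure_union_le _ _
    _ ≤ _ := by gcongr

end Core

/-! ### The prescribed subsample sizes and numbers of rounds -/

section Rates

open Filter Topology

lemma tendsto_log_natCast_atTop : Tendsto (fun n : ℕ => Real.log n) atTop atTop :=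
  Real.tendsto_log_atTop.comp tendsto_natCast_atTop_atTop

lemma tendsto_pow_log_div_natCast (k : ℕ) :
    Tendsto (fun n : ℕ => Real.log n ^ k / n) atTop (𝓝 0) := by
  have := (Real.tendsto_pow_log_div_mul_add_atTop 1 0 k one_ne_zero).comp
    tendsto_natCast_atTop_atTop
  simpa [Function.comp_def] using this

/-- For `u = ρ n`, which is comparable to `n`: the logarithms differ by at most a constant,
eventually less than half of `log n`. -/
lemma eventually_log_mem {γ : ℝ} (hγ : 0 < γ) : ∀ᶠ n : ℕ in atTop, ∀ u : ℝ, γ * n ≤ u → u ≤ n →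
    Real.log n / 2 ≤ Real.log u ∧ Real.log u ≤ Real.log n ∧ 1 ≤ u := by
  filter_upwards [tendsto_log_natCast_atTop.eventually_ge_atTop (-2 * Real.log γ),
    (tendsto_natCast_atTop_atTop (R := ℝ)).eventually_ge_atTop (1 / γ),
    eventually_gt_atTop 0] with n h1 h2 h3 u hu hun
  have hn : (0 : ℝ) < n := by exact_mod_cast h3
  have hγn : 0 < γ * n := by positivity
  have h4 : 1 ≤ γ * n := by rwa [div_le_iff₀' hγ] at h2
  refine ⟨?_, Real.log_le_log (hγn.trans_le hu) hun, h4.trans hu⟩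
  calc Real.log n / 2 ≤ Real.log γ + Real.log n := by linarith
    _ = Real.log (γ * n) := (Real.log_mul hγ.ne' hn.ne').symm
    _ ≤ _ := Real.log_le_log hγn hu

lemma half_le_of_abs_sub_lt_one {B b : ℝ} (h : |B - b| < 1) (hb : 2 ≤ b) : b / 2 ≤ B := by
  have := (abs_lt.1 h).1
  linarith

/-- Here all three errors balance: up to constants, `s * log n / n` and `log n / B` equal `φ ^ 2`,
and `(log n / s) ^ (α / d)` equals `φ`. The summands of `A` absorb, in turn, the martingale, bias
and bagging constants. -/
lemma rate_of_two_mul_lt {d α γ Λ : ℝ} (hα : 0 ≤ α) (hd : 2 * α < d) (hγ : 0 < γ) (hΛ : 0 < Λ) :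
    ∀ᶠ n : ℕ in atTop, ∀ u : ℝ, γ * n ≤ u → u ≤ n → ∀ s b φ A : ℝ,
      s = u ^ (d / (2 * α + d)) * Real.log u ^ ((2 * α - d) / (2 * α + d)) →
      b = u ^ (2 * α / (2 * α + d)) * Real.log u ^ ((d - 2 * α) / (2 * α + d)) →
      φ = (Real.log n ^ 2 / n) ^ (α / (2 * α + d)) →
      A = 2 + (1 / γ) ^ (α / (2 * α + d)) + 4 / γ ^ (2 * α / (2 * α + d)) →
      s ≤ u ∧ s * Real.log n / n ≤ A * φ ^ 2 ∧ (Real.log n / s) ^ (α / d) ≤ A * φ ∧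
        Λ * Real.log n ≤ s ∧ ∀ B : ℝ, |B - b| < 1 → Real.log n ≤ A * φ ^ 2 * B := by
  have hd0 : 0 < d := by linarith
  have hD : 0 < 2 * α + d := by linarith
  set e₁ := d / (2 * α + d) with he₁
  set e₂ := (d - 2 * α) / (2 * α + d) with he₂
  set e₃ := 2 * α / (2 * α + d) with he₃
  set a := α / (2 * α + d) with ha
  have he₁0 : 0 < e₁ := by positivity
  have he₂0 : 0 < e₂ := div_pos (by linarith) hD
  have he₃0 : 0 ≤ e₃ := by positivity
  have ha0 : 0 ≤ a := by positivity
  have he13 : e₁ = 1 - e₃ := by rw [he₁, he₃]; field_simp; ring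
  have he23 : 1 - e₂ = 2 * e₃ := by rw [he₂, he₃]; field_simp; ring
  have he12 : 1 + e₂ = 2 * e₁ := by rw [he₂, he₁]; field_simp; ring
  have hea : e₃ = 2 * a := by rw [he₃, ha]; ring
  have hea' : e₁ * (α / d) = a := by rw [he₁, ha]; field_simp
  have hneg : (2 * α - d) / (2 * α + d) = -e₂ := by rw [he₂]; ring
  have he₂1 : e₂ ≤ 1 := by linarith
  have he₁1 : e₁ ≤ 1 := by linarith
  have hlim : Tendsto (fun n : ℕ => (1 / γ * (Real.log n ^ 2 / n)) ^ e₁) atTop (𝓝 0) := by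
    have h := ((tendsto_pow_log_div_natCast 2).const_mul (1 / γ)).rpow_const
      (p := e₁) (Or.inr he₁0.le)
    rwa [mul_zero, Real.zero_rpow he₁0.ne'] at h
  have hlim2 : Tendsto (fun n : ℕ => (Real.log n / 2) ^ e₂) atTop atTop :=
    (tendsto_rpow_atTop he₂0).comp (tendsto_log_natCast_atTop.atTop_div_const two_pos)
  filter_upwards [eventually_log_mem hγ, eventually_gt_atTop 0,
    tendsto_log_natCast_atTop.eventually_ge_atTop 2, hlim.eventually_le_const (by positivity : 0 < 1 / Λ),
    hlim2.eventually_ge_atTop 2] with n hlog hn hL2 hsmall hbig u hγu hun s b φ A hs hb hφ hA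
  have hn' : (0 : ℝ) < n := by exact_mod_cast hn
  obtain ⟨hl1, hl2, hu1⟩ := hlog u hγu hun
  set L := Real.log n
  set l := Real.log u
  have hL0 : 0 < L := by linarith
  have hl0 : 0 < l := by linarith
  have hu0 : 0 < u := by linarith
  have hl1' : 1 ≤ l := by linarith
  rw [hneg] at hs
  have hs0 : 0 < s := by rw [hs]; positivity
  have hφ0 : 0 < φ := by rw [hφ]; positivity
  have hφ2 : φ ^ 2 = L ^ (1 - e₂) / (n : ℝ) ^ e₃ := by
    rw [hφ, ← Real.rpow_natCast (_ ^ a), ← Real.rpow_mul (by positivity),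
      Real.div_rpow (by positivity) hn'.le, ← Real.rpow_natCast L 2, ← Real.rpow_mul hL0.le, he23,
      hea]
    push_cast
    congr 2 <;> ring
  have hA2 : 2 ≤ A := by
    rw [hA]
    have : 0 ≤ (1 / γ) ^ a := by positivity
    have : 0 ≤ 4 / γ ^ e₃ := by positivity
    linarith
  have hLs : L / s ≤ (1 / γ * (L ^ 2 / n)) ^ e₁ := by
    have h1 : (γ * n) ^ e₁ * L ^ (-e₂) ≤ s := by
      rw [hs]
      gcongr ?_ * ?_
      · gcongr
      · exact Real.rpow_le_rpow_of_nonpos hl0 hl2 (by linarith)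
    calc L / s ≤ L / ((γ * n) ^ e₁ * L ^ (-e₂)) := by gcongr
      _ = L ^ (1 + e₂) / (γ * n) ^ e₁ := by
          rw [Real.rpow_neg hL0.le, Real.rpow_add hL0, Real.rpow_one]
          field_simp
      _ = _ := by
          rw [he12, Real.rpow_mul hL0.le, ← Real.div_rpow (by positivity) (by positivity)]
          congr 1
          rw [Real.rpow_two]
          field_simp
  refine ⟨?_, ?_, ?_, ?_, ?_⟩
  · calc s = u ^ e₁ * l ^ (-e₂) := hs
      _ ≤ u ^ (1 : ℝ) * 1 := by
          gcongr ?_ * ?_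
          · exact Real.rpow_le_rpow_of_exponent_le hu1 he₁1
          · exact Real.rpow_le_one_of_one_le_of_nonpos hl1' (by linarith)
      _ = u := by simp
  · have h1 : s ≤ (n : ℝ) ^ e₁ * (L / 2) ^ (-e₂) := by
      rw [hs]
      gcongr ?_ * ?_
      · gcongr
      · exact Real.rpow_le_rpow_of_nonpos (by positivity) hl1 (by linarith)
    have h2 : (2 : ℝ) ^ e₂ ≤ 2 := by
      calc (2 : ℝ) ^ e₂ ≤ 2 ^ (1 : ℝ) :=
            Real.rpow_le_rpow_of_exponent_le one_le_two he₂1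
        _ = 2 := Real.rpow_one 2
    calc s * L / n ≤ (n : ℝ) ^ e₁ * (L / 2) ^ (-e₂) * L / n := by gcongr
      _ = 2 ^ e₂ * φ ^ 2 := by
          rw [hφ2, he13, Real.rpow_sub hn', Real.rpow_sub hL0, Real.rpow_neg (by positivity),
            Real.div_rpow hL0.le (by norm_num), Real.rpow_one, Real.rpow_one]
          field_simp
      _ ≤ A * φ ^ 2 := by gcongr; exact h2.trans hA2
  · calc (L / s) ^ (α / d) ≤ ((1 / γ * (L ^ 2 / n)) ^ e₁) ^ (α / d) := by gcongr
      _ = (1 / γ) ^ a * φ := by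
          rw [← Real.rpow_mul (by positivity), hea', Real.mul_rpow (by positivity) (by positivity),
            hφ]
      _ ≤ A * φ := by
          gcongr
          rw [hA]
          have : 0 ≤ 4 / γ ^ e₃ := by positivity
          linarith
  · have h := hLs.trans hsmall
    rw [div_le_div_iff₀ hs0 hΛ] at h
    linarith
  · intro B hB
    have hb1 : (γ * n) ^ e₃ * (L / 2) ^ e₂ ≤ b := by rw [hb]; gcongr
    have hb2 : 2 ≤ b := by
      rw [hb]
      calc (2 : ℝ) ≤ 1 * (L / 2) ^ e₂ := by rw [one_mul]; exact hbig
        _ ≤ u ^ e₃ * l ^ e₂ := by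
            gcongr
            exact Real.one_le_rpow hu1 he₃0
    have hB2 := half_le_of_abs_sub_lt_one hB hb2
    have h2 : (2 : ℝ) ^ e₂ ≤ 2 := by
      calc (2 : ℝ) ^ e₂ ≤ 2 ^ (1 : ℝ) :=
            Real.rpow_le_rpow_of_exponent_le one_le_two he₂1
        _ = 2 := Real.rpow_one 2
    have hA4 : 4 / γ ^ e₃ ≤ A := by
      rw [hA]
      have : 0 ≤ (1 / γ) ^ a := by positivity
      linarith
    -- The `4` pays for two halvings: `b / 2 ≤ B` from rounding, and `2 ^ e₂ ≤ 2` from `log u ≥ log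
    -- n / 2`.
    calc L = 4 / γ ^ e₃ * φ ^ 2 * ((γ * n) ^ e₃ * (L / 2) ^ e₂ / 2) * (2 ^ e₂ / 2) := by
          rw [hφ2, Real.mul_rpow hγ.le hn'.le, Real.rpow_sub hL0, Real.div_rpow hL0.le (by norm_num),
            Real.rpow_one]
          field_simp
          norm_num
      _ ≤ A * φ ^ 2 * (b / 2) * 1 := by
          gcongr
          exact (div_le_one two_pos).2 h2
      _ ≤ A * φ ^ 2 * B := by rw [mul_one]; gcongr

/-- With `s` of order `√(n log n)`, the subsampling and bagging errors are both of order `(log³ n /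
n) ^ (1/4)`, and the bias is of order `(log n / n) ^ (α / (2d))`; `φ` is their maximum. -/
lemma rate_of_le_two_mul {d α γ Λ : ℝ} (hd0 : 0 < d) (hα : 0 ≤ α) (hγ : 0 < γ) (hΛ : 0 < Λ) :
    ∀ᶠ n : ℕ in atTop, ∀ u : ℝ, γ * n ≤ u → u ≤ n → ∀ s b φ A : ℝ,
      s = (u * Real.log u) ^ (1 / 2 : ℝ) →
      b = (u / Real.log u) ^ (1 / 2 : ℝ) →
      φ = max ((Real.log n / n) ^ (α / (2 * d))) ((Real.log n ^ 3 / n) ^ (1 / 4 : ℝ)) →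
      A = 1 + (2 / γ) ^ (α / (2 * d)) + 2 / √γ →
      s ≤ u ∧ s * Real.log n / n ≤ A * φ ^ 2 ∧ (Real.log n / s) ^ (α / d) ≤ A * φ ∧
        Λ * Real.log n ≤ s ∧ ∀ B : ℝ, |B - b| < 1 → Real.log n ≤ A * φ ^ 2 * B := by
  have hlim : Tendsto (fun n : ℕ => √(2 / γ * (Real.log n ^ 1 / n))) atTop (𝓝 0) := by
    have h := ((tendsto_pow_log_div_natCast 1).const_mul (2 / γ)).sqrt
    rwa [mul_zero, Real.sqrt_zero] at h
  filter_upwards [eventually_log_mem hγ, eventually_gt_atTop 0,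
    tendsto_log_natCast_atTop.eventually_ge_atTop 2, hlim.eventually_le_const (by positivity : 0 < 1 / Λ),
    (tendsto_pow_log_div_natCast 1).eventually_le_const (by positivity : 0 < γ / 4)]
    with n hlog hn hL2 hsmall hbig u hγu hun s b φ A hs hb hφ hA
  have hn' : (0 : ℝ) < n := by exact_mod_cast hn
  obtain ⟨hl1, hl2, hu1⟩ := hlog u hγu hun
  rw [pow_one] at hsmall hbig
  rw [← Real.sqrt_eq_rpow] at hs hb
  set L := Real.log n
  set l := Real.log u
  have hL0 : 0 < L := by linarith
  have hl0 : 0 < l := by linarith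
  have hu0 : 0 < u := by linarith
  have hs0 : 0 < s := by rw [hs]; positivity
  have hφ0 : 0 < φ := by rw [hφ]; positivity
  have hφ1 : (L / n) ^ (α / (2 * d)) ≤ φ := hφ ▸ le_max_left _ _
  have hφ2 : √(L ^ 3 / n) ≤ φ ^ 2 := by
    have h : (L ^ 3 / n) ^ (1 / 4 : ℝ) ≤ φ := hφ ▸ le_max_right _ _
    calc √(L ^ 3 / n) = ((L ^ 3 / n) ^ (1 / 4 : ℝ)) ^ 2 := by
          rw [← Real.rpow_natCast (_ ^ (1 / 4 : ℝ)), ← Real.rpow_mul (by positivity),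
            Real.sqrt_eq_rpow]
          norm_num
      _ ≤ _ := by gcongr
  have hA1 : 1 ≤ A := by
    rw [hA]
    have : 0 ≤ (2 / γ) ^ (α / (2 * d)) := by positivity
    have : 0 ≤ 2 / √γ := by positivity
    linarith
  have hLs : L / s ≤ √(2 / γ * (L / n)) := by
    have h1 : √(γ * n * (L / 2)) ≤ s := by rw [hs]; gcongr
    calc L / s ≤ L / √(γ * n * (L / 2)) := by gcongr
      _ = √(L ^ 2) / √(γ * n * (L / 2)) := by rw [Real.sqrt_sq hL0.le]
      _ = √(2 / γ * (L / n)) := by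
          rw [← Real.sqrt_div (by positivity)]
          congr 1
          field_simp
  refine ⟨?_, ?_, ?_, ?_, ?_⟩
  · rw [hs]
    refine Real.sqrt_le_iff.2 ⟨hu0.le, ?_⟩
    have : l ≤ u := (Real.log_le_sub_one_of_pos hu0).trans (by linarith)
    nlinarith
  · calc s * L / n ≤ √(n * L) * L / n := by rw [hs]; gcongr
      _ = √(n * L) * √((L / n) ^ 2) := by rw [Real.sqrt_sq (by positivity)]; ring
      _ = √(L ^ 3 / n) := by
          rw [← Real.sqrt_mul (by positivity)]
          congr 1
          field_simp
      _ ≤ 1 * φ ^ 2 := by rw [one_mul]; exact hφ2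
      _ ≤ A * φ ^ 2 := by gcongr
  · calc (L / s) ^ (α / d) ≤ √(2 / γ * (L / n)) ^ (α / d) := by gcongr
      _ = (2 / γ) ^ (α / (2 * d)) * (L / n) ^ (α / (2 * d)) := by
          rw [← Real.mul_rpow (by positivity) (by positivity), Real.sqrt_eq_rpow,
            ← Real.rpow_mul (by positivity)]
          congr 1
          field_simp
      _ ≤ A * φ := by
          gcongr
          rw [hA]
          have : 0 ≤ 2 / √γ := by positivity
          linarith
  · have h := hLs.trans hsmall
    rw [div_le_div_iff₀ hs0 hΛ] at h
    linarith
  · intro B hB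
    have hb1 : √(γ * n / L) ≤ b := by rw [hb]; gcongr
    have hb2 : 2 ≤ b := by
      refine le_trans (Real.le_sqrt_of_sq_le ?_) hb1
      rw [le_div_iff₀ hL0]
      rw [div_le_iff₀ hn'] at hbig
      linarith
    have hB2 := half_le_of_abs_sub_lt_one hB hb2
    have hA4 : 2 / √γ ≤ A := by
      rw [hA]
      have : 0 ≤ (2 / γ) ^ (α / (2 * d)) := by positivity
      linarith
    have e : √(L ^ 3 / n) * √(γ * n / L) = √γ * L := by
      rw [← Real.sqrt_mul (by positivity), ← Real.sqrt_sq hL0.le, ← Real.sqrt_mul hγ.le]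
      congr 1
      rw [Real.sqrt_sq hL0.le]
      field_simp
    calc L = 2 / √γ * √(L ^ 3 / n) * (√(γ * n / L) / 2) := by
          have h0 : √γ ≠ 0 := (Real.sqrt_pos.2 hγ).ne'
          have : 2 / √γ * √(L ^ 3 / n) * (√(γ * n / L) / 2)
              = (√(L ^ 3 / n) * √(γ * n / L)) / √γ := by ring
          rw [this, e]; field_simp
      _ ≤ A * φ ^ 2 * (b / 2) := by gcongr
      _ ≤ A * φ ^ 2 * B := by gcongr

end Rates

/-! ### The theorem: the prescribed parameters satisfy the general bound -/

lemma imbalanceRatio_mul {n d M : ℕ} (hn : 0 < n) (D : DataSet n d M) :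
    imbalanceRatio D * n = M * minorityCount D := by
  have : (n : ℝ) ≠ 0 := by positivity
  rw [imbalanceRatio, div_mul_cancel₀ _ this]

end

theorem corollary1 (d M : ℕ) (hd : 1 ≤ d) (hM : 2 ≤ M)
    (P : Measure (Feature d × Fin M)) [IsProbabilityMeasure P]
    (hX : P.map Prod.fst = volume.restrict (unitCube d))
    (hpos : ∀ m, 0 < classProb P m)
    (κ : Kernel (Feature d) (Fin M)) [IsMarkovKernel κ] [P.IsCondKernel κ]
    (α β cL cβ : ℝ) (hα : 0 ≤ α) (hβ : 0 < β) (hcL : 0 < cL) (hcβ : 0 < cβ)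
    (hholder : HolderPosterior κ α cL) (hmargin : MarginCondition P κ hM β cβ) :
    ∃ N : ℕ, ∃ c : ℝ, 0 < c ∧ ∀ n : ℕ, N ≤ n →
      (2 * α < d → ∀ B : DataSet n d M → ℕ,
        IsRounding B (fun D => (imbalanceRatio D * n) ^ (2 * α / (2 * α + d))
          * Real.log (imbalanceRatio D * n) ^ ((d - 2 * α) / (2 * α + d))) →
        ENNReal.ofReal (1 - 5 / (n : ℝ) ^ 2) ≤
          regretBoundProb P n 1
            (fun D => (imbalanceRatio D * n) ^ ((d : ℝ) / (2 * α + d))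
              * Real.log (imbalanceRatio D * n) ^ ((2 * α - d) / (2 * α + d)))
            B
            (c * (Real.log n ^ 2 / n) ^ (α * (β + 1) / (2 * α + d)))) ∧
      (d ≤ 2 * α → ∀ B : DataSet n d M → ℕ,
        IsRounding B (fun D =>
          (imbalanceRatio D * n / Real.log (imbalanceRatio D * n)) ^ (1 / 2 : ℝ)) →
        ENNReal.ofReal (1 - 5 / (n : ℝ) ^ 2) ≤
          regretBoundProb P n 1
            (fun D => (imbalanceRatio D * n * Real.log (imbalanceRatio D * n)) ^ (1 / 2 : ℝ))
            B
            (c * max ((Real.log n / n) ^ (α / (2 * d))) ((Real.log n ^ 3 / n) ^ (1 / 4 : ℝ))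
              ^ (β + 1))) := by
  have hM0 : (0 : ℝ) < M := by positivity
  have hd0 : (0 : ℝ) < d := by exact_mod_cast hd
  obtain ⟨p₀, hp₀, hp⟩ : ∃ p₀ : ℝ, 0 < p₀ ∧ ∀ m, p₀ ≤ classProb P m := by
    have : Nonempty (Fin M) := ⟨⟨0, by omega⟩⟩
    obtain ⟨m, hm⟩ := Finite.exists_min (classProb P)
    exact ⟨_, hpos m, hm⟩
  obtain ⟨Λ, hΛ, hreg⟩ := exists_regret_bound P κ hd hM hX hp₀ hp hα hβ hcL hcβ hholder hmargin
  -- This is `γ`: a minority class of size at least `n * p₀ / 2` gives `ρ n ≥ γ n`.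
  have hγ : 0 < M * p₀ / 2 := by positivity
  have hu : ∀ {n k : ℕ}, n * p₀ / 2 ≤ k → M * k ≤ n →
      M * p₀ / 2 * n ≤ (M : ℝ) * k ∧ (M : ℝ) * k ≤ n := by
    intro n k h1 h2
    refine ⟨?_, by exact_mod_cast h2⟩
    have := mul_le_mul_of_nonneg_left h1 hM0.le
    linarith
  have hL1 : ∀ᶠ n : ℕ in Filter.atTop, 1 ≤ Real.log n :=
    tendsto_log_natCast_atTop.eventually_ge_atTop 1
  set A₁ : ℝ := 2 + (1 / (M * p₀ / 2)) ^ (α / (2 * α + d))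
    + 4 / (M * p₀ / 2) ^ (2 * α / (2 * α + d)) with hA₁
  set A₂ : ℝ := 1 + (2 / (M * p₀ / 2)) ^ (α / (2 * d)) + 2 / √(M * p₀ / 2) with hA₂
  rcases lt_or_ge (2 * α) d with hαd | hαd
  · obtain ⟨N₁, c, hc, hbound⟩ := hreg A₁ (by positivity)
    obtain ⟨N₂, hN₂⟩ := Filter.eventually_atTop.1
      ((rate_of_two_mul_lt hα hαd hγ hΛ).and hL1)
    refine ⟨max 1 (max N₁ N₂), c, hc, fun n hn =>
      ⟨fun _ B hB => ?_, fun h => absurd h (not_le.2 hαd)⟩⟩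
    have hn0 : 0 < n := by omega
    have hn' : (1 : ℝ) ≤ n := by exact_mod_cast hn0
    obtain ⟨hrate, hL⟩ := hN₂ n (by omega)
    -- The exponent `α / (2α + d)` is below `1 / 2`, and the logarithm is at least one.
    have hφ : (n : ℝ) ^ (-(1 / 2) : ℝ) ≤ (Real.log n ^ 2 / n) ^ (α / (2 * α + d)) := by
      calc (n : ℝ) ^ (-(1 / 2) : ℝ) ≤ (n : ℝ) ^ (-(α / (2 * α + d))) := by
            apply Real.rpow_le_rpow_of_exponent_le hn'
            rw [neg_le_neg_iff, div_le_div_iff₀ (by positivity) two_pos]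
            linarith
        _ = (1 / n) ^ (α / (2 * α + d)) := by
            rw [Real.rpow_neg (by positivity), one_div, Real.inv_rpow (by positivity)]
        _ ≤ _ := by
            gcongr
            exact one_le_pow₀ hL
    have hrw : (Real.log n ^ 2 / n) ^ (α * (β + 1) / (2 * α + d)) =
        ((Real.log n ^ 2 / n) ^ (α / (2 * α + d))) ^ (β + 1) := by
      rw [← Real.rpow_mul (by positivity)]
      congr 1
      ring
    rw [hrw]
    -- Because `ρ n = M * k` with `k` the minority count, `s` depends on the data only through `k`,
    -- as freezing the counts requires.
    refine hbound n (by omega) _ hφ (fun k => ((M : ℝ) * k) ^ ((d : ℝ) / (2 * α + d))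
      * Real.log (M * k) ^ ((2 * α - d) / (2 * α + d))) _ B
      (fun D => by rw [imbalanceRatio_mul hn0]) (fun k hk1 hk2 => ?_) (fun D hk1 hk2 => ?_)
    · obtain ⟨h1, h2⟩ := hu hk1 hk2
      obtain ⟨h3, h4, h5, h6, _⟩ := hrate _ h1 h2 _ _ _ A₁ rfl rfl rfl hA₁
      exact ⟨h3, h4, h5, h6⟩
    · obtain ⟨h1, h2⟩ := hu hk1 hk2
      obtain ⟨_, _, _, _, h7⟩ := hrate _ h1 h2 _ _ _ A₁ rfl rfl rfl hA₁
      have := hB D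
      dsimp only at this
      rw [imbalanceRatio_mul hn0] at this
      exact h7 _ this
  · obtain ⟨N₁, c, hc, hbound⟩ := hreg A₂ (by positivity)
    obtain ⟨N₂, hN₂⟩ := Filter.eventually_atTop.1
      ((rate_of_le_two_mul hd0 hα hγ hΛ).and hL1)
    refine ⟨max 1 (max N₁ N₂), c, hc, fun n hn =>
      ⟨fun h => absurd hαd (not_le.2 h), fun _ B hB => ?_⟩⟩
    have hn0 : 0 < n := by omega
    have hn' : (1 : ℝ) ≤ n := by exact_mod_cast hn0
    obtain ⟨hrate, hL⟩ := hN₂ n (by omega)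
    have hφ : (n : ℝ) ^ (-(1 / 2) : ℝ) ≤
        max ((Real.log n / n) ^ (α / (2 * d))) ((Real.log n ^ 3 / n) ^ (1 / 4 : ℝ)) := by
      refine le_trans ?_ (le_max_right _ _)
      calc (n : ℝ) ^ (-(1 / 2) : ℝ) ≤ (n : ℝ) ^ (-(1 / 4) : ℝ) :=
            Real.rpow_le_rpow_of_exponent_le hn' (by norm_num)
        _ = (1 / n) ^ (1 / 4 : ℝ) := by
            rw [Real.rpow_neg (by positivity), one_div (n : ℝ), Real.inv_rpow (by positivity)]
        _ ≤ _ := by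
            gcongr
            exact one_le_pow₀ hL
    refine hbound n (by omega) _ hφ
      (fun k => ((M : ℝ) * k * Real.log (M * k)) ^ (1 / 2 : ℝ)) _ B
      (fun D => by rw [imbalanceRatio_mul hn0]) (fun k hk1 hk2 => ?_) (fun D hk1 hk2 => ?_)
    · obtain ⟨h1, h2⟩ := hu hk1 hk2
      obtain ⟨h3, h4, h5, h6, _⟩ := hrate _ h1 h2 _ _ _ A₂ rfl rfl rfl hA₂
      exact ⟨h3, h4, h5, h6⟩
    · obtain ⟨h1, h2⟩ := hu hk1 hk2
      obtain ⟨_, _, _, _, h7⟩ := hrate _ h1 h2 _ _ _ A₂ rfl rfl rfl hA₂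
      have := hB D
      dsimp only at this
      rw [imbalanceRatio_mul hn0] at this
      exact h7 _ this
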